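/- Conventions. For an $m\times m$ matrix $U$, where $U_{ji}$ is the amplitude of a photon going from mode $i$ to mode $j$, let $\varphi(U)$ be the induced operator on the Fock space of $m$ bosonic modes: writing the Fock state $|s_1,\dots,s_m\rangle$ as $x_1^{s_1}\cdots x_m^{s_m}/\sqrt{s_1!\cdots s_m!}$ (these states being orthonormal), $\varphi(U)$ is the algebra homomorphism with $x_i\mapsto\sum_j U_{ji}x_j$. An $n$-qubit circuit $Q$ is a finite sequence of gates, each being either a CSIGN gate ($|x\rangle\mapsto(-1)^{x_ix_j}|x\rangle$) on two distinct qubits $i,j$, or a real single-qubit gate (an arbitrary orthogonal $2\times2$ real matrix) on one qubit. Theorem. For every $n$-qubit circuit $Q$ of CSIGN gates and real single-qubit gates, with $\Gamma$ CSIGN gates, there is a linear optical circuit on $4n+2\Gamma$ modes, given by a real orthogonal matrix $O$, such that $$\langle 1,\dots,1|\varphi(O)|1,\dots,1\rangle=\left(\frac13\sqrt{\frac23}\right)^{\Gamma}\left(\frac{-1}{\sqrt6}\right)^{n}\langle 0^n|Q|0^n\rangle .$$ Moreover, such an $O$ can be computed from $Q$ in polynomial time: there are one program and one polynomial $p$ such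 that for every $n$ and every such circuit $Q$ with $L$ gates, the program, given the list of gates of $Q$ (the types of the gates, the qubits they act on, and the entries of the single-qubit gates), outputs all entries of such an $O$ within $p(n+L)$ steps (hence in time polynomial in $n$ when $Q$ has polynomially many gates). Here a program is one for a random access machine with real memory cells, whose only arithmetic operations on real numbers are addition, multiplication by an entry of an input gate, and multiplication by one of finitely many algebraic constants fixed in the program (cells may also be copied or set to such a constant), and which can clear, copy, compare and increment integers, branch on equality of integers, and repeat a block a number of times given by an integer. -/

import Mathlib

noncomputable section

/-! ## Linear optics -/

namespace LinearOptics

/-- The Fock space of `m` bosonic modes (all photon numbers together), with Fock states represented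
by monomials: `X_1^{s_1} ⋯ X_m^{s_m}` is a multiple of `|s_1, …, s_m⟩`. The `k`-photon space is the
space of homogeneous polynomials of degree `k`. -/
abbrev FockSpace (m : ℕ) : Type := MvPolynomial (Fin m) ℂ

/-- `s_1! ⋯ s_m!` -/
def occFactorial {m : ℕ} (S : Fin m →₀ ℕ) : ℕ := ∏ i, (S i).factorial

/-- The inner product of Fock space (conjugate linear in the first argument): distinct monomials are
orthogonal and `X^S` has squared norm `s_1! ⋯ s_m!`. -/
def fockInner {m : ℕ} (f g : FockSpace m) : ℂ :=
  ∑ S ∈ f.support,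
    (occFactorial S : ℂ) * (starRingEnd ℂ (MvPolynomial.coeff S f) * MvPolynomial.coeff S g)

/-- The Fock basis state `|s_1, …, s_m⟩ = X^S / √(s_1! ⋯ s_m!)`. -/
def fockState {m : ℕ} (S : Fin m →₀ ℕ) : FockSpace m :=
  MvPolynomial.monomial S (((Real.sqrt (occFactorial S))⁻¹ : ℝ) : ℂ)

/-- The lift `φ(U)` of a one-photon transition matrix `U` to Fock space, where `U j i` is the
amplitude of a photon going from mode `i` to mode `j`: the algebra map with
`X_i ↦ ∑ j, U j i X_j`. -/
def phi {m : ℕ} (U : Matrix (Fin m) (Fin m) ℂ) : FockSpace m →ₗ[ℂ] FockSpace m :=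
  (MvPolynomial.aeval fun i : Fin m =>
    ∑ j : Fin m, U j i • (MvPolynomial.X j : FockSpace m)).toLinearMap

/-- The transition amplitude `⟨T| φ(U) |S⟩`. -/
def amplitude {m : ℕ} (U : Matrix (Fin m) (Fin m) ℂ) (T S : Fin m →₀ ℕ) : ℂ :=
  fockInner (fockState T) (phi U (fockState S))

/-- The occupation numbers `1, 1, …, 1`: one photon in every mode. -/
def allOnes (m : ℕ) : Fin m →₀ ℕ := Finsupp.equivFunOnFinite.symm fun _ => 1

end LinearOptics

/-! ## Qubit circuits of CSIGN gates and real single-qubit gates -/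

namespace QubitCircuit

/-- A gate on `n` qubits: a real single-qubit gate (a real unitary, that is, orthogonal, `2 × 2`
matrix `G`) applied to qubit `q`, or a CSIGN gate on two distinct qubits. -/
inductive Gate (n : ℕ) : Type
  | single (q : Fin n) (G : Matrix.orthogonalGroup (Fin 2) ℝ) : Gate n
  | csign (i j : Fin n) (hij : i ≠ j) : Gate n

/-- The operator of a gate, in the computational basis `|x⟩`, `x : Fin n → Fin 2`, of the space of
`n` qubits. -/
def Gate.toMatrix {n : ℕ} : Gate n → Matrix (Fin n → Fin 2) (Fin n → Fin 2) ℂ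
  | .single q G => Matrix.of fun x y =>
      if ∀ k, k ≠ q → x k = y k then ((G.1 (x q) (y q) : ℝ) : ℂ) else 0
  | .csign i j _ => Matrix.diagonal fun x => if x i = 1 ∧ x j = 1 then -1 else 1

/-- Is the gate a CSIGN gate? -/
def Gate.isCsign {n : ℕ} : Gate n → Bool
  | .single _ _ => false
  | .csign _ _ _ => true

/-- A circuit is the list of its gates; the head of the list is applied first. -/
abbrev Circuit (n : ℕ) : Type := List (Gate n)

/-- The operator of a circuit. -/
def Circuit.toMatrix {n : ℕ} : Circuit n → Matrix (Fin n → Fin 2) (Fin n → Fin 2) ℂ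
  | [] => 1
  | g :: gs => Circuit.toMatrix gs * g.toMatrix

/-- The number `Γ` of CSIGN gates. -/
def Circuit.csignCount {n : ℕ} (Q : Circuit n) : ℕ := Q.countP Gate.isCsign

/-- The amplitude `⟨0^n| Q |0^n⟩`. -/
def Circuit.zeroAmplitude {n : ℕ} (Q : Circuit n) : ℂ := Circuit.toMatrix Q 0 0

end QubitCircuit

/-! ## Programs over the real numbers, with a step count

The machine has integer registers, which can only be copied, cleared, incremented, compared and
filled from the input, and a real memory whose cells are addressed by pairs of integer registers.
Its instructions on real numbers are addition, multiplication by a number of the input, and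
multiplication by one of finitely many algebraic constants of the program. There are no tests,
divisions or roundings of real numbers, and two computed numbers cannot be multiplied. So this is a
restricted real random access machine, on which numbers cannot grow quickly by repeated squaring:
integers grow by at most 1 in a step, and if the numbers of the input lie in a number field, then
`T` steps produce numbers of the field extended by the constants, of bit length polynomial in `T`
and in the bit length of the input. -/

namespace RealMachine

/-- A read-only input: a table of natural numbers and a table of real numbers. -/
structure Input : Type where
  word : ℕ → ℕ → ℕ
  real : ℕ → ℕ → ℝ

/-- The state: the integer registers and the real memory. -/
structure State : Type where
  reg : ℕ → ℕ
  mem : ℕ → ℕ → ℝ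

/-- Instructions; all arguments other than the constants are names of integer registers. A pair
`i j` stands for the memory cell whose address is the pair of contents of the registers `i`, `j`,
and a pair `a b` for the input entry so addressed. -/
inductive Instr : Type
  /-- `reg r := 0` -/
  | clear (r : ℕ)
  /-- `reg r := reg r + 1` -/
  | succ (r : ℕ)
  /-- `reg r := reg s` -/
  | copy (r s : ℕ)
  /-- `reg r := word[a, b]` -/
  | read (r a b : ℕ)
  /-- `mem[i, j] := c` -/
  | const (i j : ℕ) (c : {c : ℝ // IsAlgebraic ℚ c})
  /-- `mem[i, j] := mem[k, l]` -/
  | move (i j k l : ℕ)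
  /-- `mem[i, j] := mem[i, j] + mem[k, l]` -/
  | add (i j k l : ℕ)
  /-- `mem[i, j] := c * mem[i, j]` -/
  | scale (i j : ℕ) (c : {c : ℝ // IsAlgebraic ℚ c})
  /-- `mem[i, j] := real[a, b] * mem[i, j]` -/
  | scaleInput (i j a b : ℕ)

/-- Overwrite an integer register. -/
def State.setReg (s : State) (r v : ℕ) : State :=
  { s with reg := Function.update s.reg r v }

/-- The memory cell addressed by the registers `i`, `j`. -/
def State.cell (s : State) (i j : ℕ) : ℝ := s.mem (s.reg i) (s.reg j)

/-- Overwrite the memory cell addressed by the registers `i`, `j`. -/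
def State.setCell (s : State) (i j : ℕ) (v : ℝ) : State :=
  { s with mem := fun a b => if a = s.reg i ∧ b = s.reg j then v else s.mem a b }

/-- The effect of an instruction. -/
def Instr.exec (inp : Input) : Instr → State → State
  | .clear r, s => s.setReg r 0
  | .succ r, s => s.setReg r (s.reg r + 1)
  | .copy r r', s => s.setReg r (s.reg r')
  | .read r a b, s => s.setReg r (inp.word (s.reg a) (s.reg b))
  | .const i j c, s => s.setCell i j c.1
  | .move i j k l, s => s.setCell i j (s.cell k l)
  | .add i j k l, s => s.setCell i j (s.cell i j + s.cell k l)
  | .scale i j c, s => s.setCell i j (c.1 * s.cell i j)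
  | .scaleInput i j a b, s => s.setCell i j (inp.real (s.reg a) (s.reg b) * s.cell i j)

/-- Programs: finite texts, which do not depend on the input. -/
inductive Program : Type
  | instr (a : Instr)
  | seq (P P' : Program)
  /-- if `reg r = reg s` then `P` else `P'` -/
  | ifEq (r s : ℕ) (P P' : Program)
  /-- repeat `P` as many times as the content of `reg r` when the loop is entered -/
  | loop (r : ℕ) (P : Program)

/-- Running a program: the final state and the number of steps. Every instruction, every comparison,
every entry into a loop and every round of a loop counts as a step. -/
def Program.run (inp : Input) : Program → State → State × ℕ
  | .instr a, s => (a.exec inp s, 1)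
  | .seq P P', s =>
      ((P'.run inp (P.run inp s).1).1, (P.run inp s).2 + (P'.run inp (P.run inp s).1).2)
  | .ifEq r r' P P', s =>
      if s.reg r = s.reg r' then ((P.run inp s).1, (P.run inp s).2 + 1)
      else ((P'.run inp s).1, (P'.run inp s).2 + 1)
  | .loop r P, s =>
      (fun u : State × ℕ => ((P.run inp u.1).1, u.2 + (P.run inp u.1).2 + 1))^[s.reg r] (s, 1)

end RealMachine

/-! ## Circuits as inputs -/

namespace QubitCircuit

open RealMachine

/-- The integers that describe a gate: `0, q` for a single-qubit gate on qubit `q`, and `1, i, j`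
for a CSIGN gate on the qubits `i` and `j`. -/
def Gate.words {n : ℕ} : Gate n → ℕ → ℕ
  | .single _ _, 0 => 0
  | .single q _, 1 => q
  | .csign _ _ _, 0 => 1
  | .csign i _ _, 1 => i
  | .csign _ j _, 2 => j
  | _, _ => 0

/-- The real numbers that describe a gate: for a single-qubit gate, the four entries of its matrix,
row by row. -/
def Gate.reals {n : ℕ} : Gate n → ℕ → ℝ
  | .single _ G, 0 => G.1 0 0
  | .single _ G, 1 => G.1 0 1
  | .single _ G, 2 => G.1 1 0
  | .single _ G, 3 => G.1 1 1
  | _, _ => 0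

/-- The input tables of a circuit: row `k` describes the `k`-th gate (counted from 0). -/
def Circuit.toInput {n : ℕ} (Q : Circuit n) : Input where
  word k a := match Q[k]? with
    | some g => g.words a
    | none => 0
  real k a := match Q[k]? with
    | some g => g.reals a
    | none => 0

/-- The initial state: register 0 holds the number of qubits, register 1 the number of gates,
and all else is zero. -/
def Circuit.initState {n : ℕ} (Q : Circuit n) : State where
  reg r := if r = 0 then n else if r = 1 then Q.length else 0
  mem _ _ := 0

end QubitCircuit

namespace RealMachine

/-- Started on the circuit `Q`, the program `P` stops after at most `t` steps, with the size `N` of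
the matrix `A` in register 0 and the entry `A i j` in the memory cell with address `(i, j)`. -/
def Program.Computes (P : Program) {n : ℕ} (Q : QubitCircuit.Circuit n) {N : ℕ}
    (A : Matrix (Fin N) (Fin N) ℝ) (t : ℕ) : Prop :=
  (P.run Q.toInput Q.initState).2 ≤ t ∧
  (P.run Q.toInput Q.initState).1.reg 0 = N ∧
  ∀ i j : Fin N, (P.run Q.toInput Q.initState).1.mem i j = A i j

end RealMachine

end

noncomputable section

set_option linter.unusedSectionVars false

/-! A qubit occupies four modes. In the state `live b` one photon sits in mode `b` (0 or 1), two in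
mode 2 and one in mode 3. A single-qubit gate is then a linear map of modes 0 and 1. Knill's
four-mode gate, applied to mode 1 of two qubits and to a fresh pair of helper modes, is a controlled
sign with factor `√6 / 9`, provided each helper mode contains one photon before and after.

The difficulty is to start and end in `1, …, 1` without intermediate measurements. The encoder is a
beam splitter taking `x₀x₁x₂x₃` to `x₀(x₁² - x₂²)x₃ / 2`: the encoded zero with coefficient `-1/2`,
plus an unwanted branch. That branch has 0 and 1 photons in modes 2 and 3, which no gate touches
before the decoder, so it stays recognizable. The decoder is chosen so that the coefficient of
`x₀x₁x₂x₃` is `√6 / 3` from `live 0`, zero from `live 1`, and zero from every state with 0 and 1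
photons in modes 2 and 3. Each qubit thus contributes `(-1/2)(√6 / 3) = -1/√6`. A helper pair is not
touched after its gate, so requiring one photon in each helper mode at the end already performs the
post-selection.

Formally, states are polynomials known modulo `vanishing G`, those without monomials in the relevant
set `G`. If every transition into `G'` starts in `G`, a gate carries a congruence modulo `vanishing
G` to one modulo `vanishing G'` (`lift_sub_mem_vanishing`). The gates enter through `lift_encoder`,
`lift_rotation`, `lift_knill`, `cf_decoder_live` and `cf_decoder_eq_zero`; the congruences are
chained by `Encoded`, `Encodes` and `Decoded`.

The program multiplies the identity matrix on the left by these gates. Each gate changes four rows,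
at a cost linear in the number of modes. With `2n + L` gates and at most `4n + 2L` modes the total
is quadratic in `n + L`. The invariant `Holds` says that the memory contains an orthogonal matrix
whose action on `1, …, 1` satisfies the current congruence. -/

/-! ## Linear optics over the reals, with an arbitrary finite set of modes -/

namespace Optics

open MvPolynomial

variable {R : Type*} [CommRing R] {ι κ : Type*} [Fintype ι] [Fintype κ]

/-- The monomial with the given exponents. -/
def mono (R : Type*) [CommRing R] (s : ι → ℕ) : MvPolynomial ι R :=
  monomial (Finsupp.equivFunOnFinite.symm s) 1

/-- The coefficient of the monomial with the given exponents. -/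
def cf (t : ι → ℕ) : MvPolynomial ι R →ₗ[R] R := lcoeff R (Finsupp.equivFunOnFinite.symm t)

theorem cf_mono [DecidableEq ι] (s t : ι → ℕ) : cf t (mono R s) = if s = t then 1 else 0 := by
  classical
  simp only [cf, mono, lcoeff_apply, coeff_monomial, Equiv.apply_eq_iff_eq]

theorem mono_eq_prod (s : ι → ℕ) : mono R s = ∏ i, X i ^ s i := by
  rw [mono, monomial_eq, Finsupp.prod_fintype _ _ (by simp)]
  simp

theorem mono_add (s t : ι → ℕ) : mono R (s + t) = mono R s * mono R t := by
  simp [mono_eq_prod, pow_add, Finset.prod_mul_distrib]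

/-- The algebra map induced by the one-photon matrix `U`. -/
def lift (U : Matrix ι ι R) : MvPolynomial ι R →ₐ[R] MvPolynomial ι R :=
  aeval fun i => ∑ j, U j i • X j

@[simp] theorem lift_X (U : Matrix ι ι R) (i : ι) : lift U (X i) = ∑ j, U j i • X j := by
  simp [lift]

theorem lift_mul (U V : Matrix ι ι R) : lift (U * V) = (lift U).comp (lift V) := by
  ext1 i
  simp only [lift_X, AlgHom.comp_apply, map_sum, map_smul, Matrix.mul_apply, Finset.sum_smul,
    Finset.smul_sum, smul_smul]
  rw [Finset.sum_comm]
  simp only [mul_comm]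

theorem lift_one [DecidableEq ι] : lift (1 : Matrix ι ι R) = AlgHom.id R _ := by
  ext1 i
  simp [Matrix.one_apply]

/-! ### Conservation laws -/

/-- Each variable is replaced by a linear form in variables of the same weight. Weight 1 everywhere
gives conservation of the photon number; the indicator of a mode gives conservation of its
occupation. -/
theorem lift_isWeightedHomogeneous (U : Matrix ι ι R) (w : ι → ℕ)
    (h : ∀ i j, U j i ≠ 0 → w j = w i) (s : ι → ℕ) :
    IsWeightedHomogeneous w (lift U (mono R s)) (∑ i, s i * w i) := by
  rw [mono_eq_prod, map_prod]
  apply IsWeightedHomogeneous.prod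
  intro i _
  rw [map_pow, lift_X]
  apply IsWeightedHomogeneous.pow
  apply Submodule.sum_mem (weightedHomogeneousSubmodule R w (w i))
  intro j _
  by_cases hU : U j i = 0
  · simp [hU]
  · apply Submodule.smul_mem
    rw [← h i j hU]
    exact isWeightedHomogeneous_X R w j

theorem weight_eq_of_cf_ne_zero (U : Matrix ι ι R) (w : ι → ℕ)
    (h : ∀ i j, U j i ≠ 0 → w j = w i) {s t : ι → ℕ} (hst : cf t (lift U (mono R s)) ≠ 0) :
    ∑ i, t i * w i = ∑ i, s i * w i := by
  have := lift_isWeightedHomogeneous U w h s hst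
  rw [Finsupp.weight_apply, Finsupp.sum_fintype _ _ (by simp)] at this
  simpa using this

/-- Photon number is conserved. -/
theorem sum_eq_of_cf_ne_zero (U : Matrix ι ι R) {s t : ι → ℕ}
    (hst : cf t (lift U (mono R s)) ≠ 0) : ∑ i, t i = ∑ i, s i := by
  simpa using weight_eq_of_cf_ne_zero U (fun _ => 1) (by simp) hst

/-- The occupation number of a mode on which `U` acts trivially is conserved. -/
theorem eq_of_cf_ne_zero (U : Matrix ι ι R) (k : ι)
    (h : ∀ j, j ≠ k → U j k = 0 ∧ U k j = 0) {s t : ι → ℕ}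
    (hst : cf t (lift U (mono R s)) ≠ 0) : t k = s k := by
  classical
  have := weight_eq_of_cf_ne_zero U (fun i => if i = k then 1 else 0) ?_ hst
  · simpa using this
  · intro i j hU
    by_cases hi : i = k <;> by_cases hj : j = k <;> simp only [hi, hj, if_true, if_false]
    · exact absurd (h j hj).1 (hi ▸ hU)
    · exact absurd (h i hi).2 (hj ▸ hU)

/-! ### Gates on a few of the modes -/

section Embed

variable [DecidableEq ι] [DecidableEq κ]

/-- The matrix of the inclusion of some of the modes. -/
def inclusion (R : Type*) [CommRing R] (e : κ → ι) : Matrix ι κ R :=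
  Matrix.of fun i r => if i = e r then 1 else 0

/-- The matrix that acts as `V` on the modes in the range of `e` and trivially on the others. -/
def embed (V : Matrix κ κ R) (e : κ → ι) : Matrix ι ι R :=
  1 + inclusion R e * (V - 1) * (inclusion R e).transpose

theorem inclusion_transpose_mul {e : κ → ι} (he : e.Injective) :
    (inclusion R e).transpose * inclusion R e = 1 := by
  ext r s
  simp [inclusion, Matrix.mul_apply, Matrix.one_apply, he.eq_iff, eq_comm]

/-- With `P` the inclusion, `Pᵀ P = 1` reduces the claim to `(V - 1) + (Vᵀ - 1) + (V - 1)(Vᵀ - 1) =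
V Vᵀ - 1 = 0`. -/
theorem embed_mul_transpose {V : Matrix κ κ R} (hV : V * V.transpose = 1) {e : κ → ι}
    (he : e.Injective) : embed V e * (embed V e).transpose = 1 := by
  have h := inclusion_transpose_mul (R := R) he
  simp only [embed, Matrix.transpose_add, Matrix.transpose_mul, Matrix.transpose_one,
    Matrix.transpose_transpose, Matrix.transpose_sub]
  set P := inclusion R e
  have h1 : P * (V - 1) * P.transpose * (P * ((V.transpose - 1) * P.transpose)) =
      P * ((V - 1) * (V.transpose - 1)) * P.transpose := by
    calc _ = P * (V - 1) * (P.transpose * P) * (V.transpose - 1) * P.transpose := by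
          simp only [Matrix.mul_assoc]
      _ = _ := by rw [h]; simp only [Matrix.mul_assoc, Matrix.one_mul]
  have h2 : (V - 1) * (V.transpose - 1) = 1 - V - V.transpose + 1 := by
    rw [Matrix.sub_mul, Matrix.mul_sub, hV]; simp; abel
  rw [Matrix.add_mul, Matrix.mul_add, Matrix.mul_add, h1, h2, Matrix.one_mul, Matrix.one_mul,
    Matrix.mul_one, ← Matrix.mul_assoc, add_assoc, add_eq_left, ← Matrix.add_mul,
    ← Matrix.add_mul, ← Matrix.mul_add, ← Matrix.mul_add]
  have h3 : V.transpose - 1 + (V - 1 + (1 - V - V.transpose + 1)) = 0 := by abel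
  rw [h3, Matrix.mul_zero, Matrix.zero_mul]

/-- Left multiplication by an embedded gate is a row operation on the rows in the range of `e`; this
is what the program carries out. -/
theorem embed_mul_apply_range (V : Matrix κ κ R) {e : κ → ι} (he : e.Injective)
    (M : Matrix ι ι R) (r : κ) (j : ι) : (embed V e * M) (e r) j = ∑ s, V r s * M (e s) j := by
  have h : ∀ s, ((inclusion R e).transpose * M) s j = M (e s) j := by
    intro s; simp [inclusion, Matrix.mul_apply]
  have h' : ∀ (B : Matrix κ ι R), (inclusion R e * B) (e r) j = B r j := by
    intro B; simp [inclusion, Matrix.mul_apply, he.eq_iff]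
  rw [embed, Matrix.add_mul, Matrix.add_apply, Matrix.one_mul, Matrix.mul_assoc, Matrix.mul_assoc,
    h', Matrix.mul_apply]
  simp [h, sub_mul, Matrix.one_apply]

theorem embed_mul_apply_off (V : Matrix κ κ R) (e : κ → ι) (M : Matrix ι ι R) (i j : ι)
    (hi : i ∉ Set.range e) : (embed V e * M) i j = M i j := by
  have h' : ∀ (B : Matrix κ ι R), (inclusion R e * B) i j = 0 := by
    intro B
    rw [Matrix.mul_apply]
    apply Finset.sum_eq_zero
    intro r _
    have : i ≠ e r := fun h => hi ⟨r, h.symm⟩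
    simp [inclusion, this]
  rw [embed, Matrix.add_mul, Matrix.add_apply, Matrix.one_mul, Matrix.mul_assoc, Matrix.mul_assoc,
    h', add_zero]

theorem embed_apply_range (V : Matrix κ κ R) {e : κ → ι} (he : e.Injective) (r : κ) (j : ι) :
    embed V e (e r) j = ∑ s, if e s = j then V r s else 0 := by
  rw [← Matrix.mul_one (embed V e), embed_mul_apply_range V he]
  simp [Matrix.one_apply]

theorem embed_apply_off (V : Matrix κ κ R) (e : κ → ι) (i j : ι) (hi : i ∉ Set.range e) :
    embed V e i j = if i = j then 1 else 0 := by
  rw [← Matrix.mul_one (embed V e), embed_mul_apply_off V e _ _ _ hi, Matrix.one_apply]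

theorem lift_embed_X_range (V : Matrix κ κ R) {e : κ → ι} (he : e.Injective) (s : κ) :
    lift (embed V e) (X (e s)) = ∑ r, V r s • X (e r) := by
  classical
  rw [lift_X]
  symm
  rw [← Finset.sum_image (s := Finset.univ) (g := e)
    (f := fun j => embed V e j (e s) • (X j : MvPolynomial ι R)) (by intro a _ b _ h; exact he h)
    |>.trans (Finset.sum_congr rfl ?_)]
  · apply Finset.sum_subset (Finset.subset_univ _)
    intro j _ hj
    have hj' : j ∉ Set.range e := by simpa using hj
    rw [embed_apply_off V e _ _ hj', if_neg, zero_smul]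
    rintro rfl
    exact hj' ⟨s, rfl⟩
  · intro r _
    rw [embed_apply_range V he]
    simp [he.eq_iff]

theorem lift_embed_X_off (V : Matrix κ κ R) {e : κ → ι} (he : e.Injective) (i : ι)
    (hi : i ∉ Set.range e) : lift (embed V e) (X i) = X i := by
  rw [lift_X, Finset.sum_eq_single i]
  · rw [embed_apply_off V e _ _ hi]; simp
  · intro j _ hj
    by_cases h : j ∈ Set.range e
    · obtain ⟨r, rfl⟩ := h
      rw [embed_apply_range V he, Finset.sum_eq_zero, zero_smul]
      intro s _
      rw [if_neg]
      rintro rfl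
      exact hi ⟨s, rfl⟩
    · rw [embed_apply_off V e _ _ h, if_neg hj, zero_smul]
  · simp

/-- Put a polynomial in the modes in the range of `e` next to the occupation numbers `u` of the
other modes. -/
def insert (e : κ → ι) (u : ι → ℕ) : MvPolynomial κ R →ₗ[R] MvPolynomial ι R :=
  (LinearMap.mulLeft R (mono R (Function.extend e (fun _ => 0) u))).comp (rename e).toLinearMap

theorem insert_apply (e : κ → ι) (u : ι → ℕ) (g : MvPolynomial κ R) :
    insert e u g = mono R (Function.extend e (fun _ => 0) u) * rename e g := rfl

theorem equivFunOnFinite_symm_mapDomain {e : κ → ι} (he : e.Injective) (t : κ → ℕ) :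
    (Finsupp.equivFunOnFinite.symm t).mapDomain e =
      Finsupp.equivFunOnFinite.symm (Function.extend e t 0) := by
  ext i
  by_cases h : i ∈ Set.range e
  · obtain ⟨r, rfl⟩ := h
    simp [Finsupp.mapDomain_apply he, he.extend_apply]
  · rw [Finsupp.mapDomain_of_notMem_range _ _ h]
    simp [Function.extend_apply' _ _ _ h]

theorem extend_zero_add_extend {e : κ → ι} (he : e.Injective) (t : κ → ℕ) (u : ι → ℕ) :
    Function.extend e (fun _ => 0) u + Function.extend e t 0 = Function.extend e t u := by
  ext i
  by_cases h : i ∈ Set.range e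
  · obtain ⟨r, rfl⟩ := h
    simp [he.extend_apply]
  · simp [Function.extend_apply' _ _ _ h]

theorem insert_mono {e : κ → ι} (he : e.Injective) (u : ι → ℕ) (t : κ → ℕ) :
    insert e u (mono R t) = mono R (Function.extend e t u) := by
  rw [insert_apply, ← extend_zero_add_extend he t, mono_add]
  congr 1
  rw [mono, rename_monomial, equivFunOnFinite_symm_mapDomain he, mono]

/-- The embedded gate is an algebra map fixing the variables outside the range of `e`, so the
spectator monomial comes out as a factor. -/
theorem lift_embed_insert (V : Matrix κ κ R) {e : κ → ι} (he : e.Injective) (u : ι → ℕ)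
    (g : MvPolynomial κ R) : lift (embed V e) (insert e u g) = insert e u (lift V g) := by
  rw [insert_apply, insert_apply, map_mul]
  congr 1
  · rw [mono_eq_prod, map_prod]
    apply Finset.prod_congr rfl
    intro i _
    rw [map_pow]
    by_cases h : i ∈ Set.range e
    · obtain ⟨r, rfl⟩ := h
      simp [he.extend_apply]
    · rw [lift_embed_X_off V he i h]
  · have : (lift (embed V e)).comp (rename e) = (rename e).comp (lift V) := by
      ext1 s
      simp [lift_embed_X_range V he, -lift_X]
      simp
    exact DFunLike.congr_fun this g

theorem cf_insert {e : κ → ι} (he : e.Injective) {u T : ι → ℕ}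
    (hT : ∀ i, i ∉ Set.range e → T i = u i) (g : MvPolynomial κ R) :
    cf T (insert e u g) = cf (T ∘ e) g := by
  have h : Finsupp.equivFunOnFinite.symm T =
      Finsupp.equivFunOnFinite.symm (Function.extend e (fun _ => 0) u) +
        (Finsupp.equivFunOnFinite.symm (T ∘ e)).mapDomain e := by
    rw [equivFunOnFinite_symm_mapDomain he]
    ext i
    by_cases h : i ∈ Set.range e
    · obtain ⟨r, rfl⟩ := h
      simp [he.extend_apply]
    · simp [Function.extend_apply' _ _ _ h, hT i h]
  rw [insert_apply, cf, lcoeff_apply, h, mono, coeff_monomial_mul, one_mul,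
    coeff_rename_mapDomain e he]
  rfl

theorem eq_off_of_cf_lift_embed_ne_zero {V : Matrix κ κ R} {e : κ → ι} (he : e.Injective)
    {S T : ι → ℕ} (h : cf T (lift (embed V e) (mono R S)) ≠ 0) (i : ι) (hi : i ∉ Set.range e) :
    T i = S i := by
  refine eq_of_cf_ne_zero (embed V e) i ?_ h
  intro j hj
  refine ⟨?_, by rw [embed_apply_off V e _ _ hi, if_neg hj.symm]⟩
  by_cases h : j ∈ Set.range e
  · obtain ⟨r, rfl⟩ := h
    rw [embed_apply_range V he, Finset.sum_eq_zero]
    intro s _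
    rw [if_neg]
    rintro rfl
    exact hi ⟨s, rfl⟩
  · rw [embed_apply_off V e _ _ h, if_neg hj]

theorem extend_comp_self {e : κ → ι} (he : e.Injective) (S : ι → ℕ) :
    Function.extend e (S ∘ e) S = S := by
  ext i
  by_cases h : i ∈ Set.range e
  · obtain ⟨r, rfl⟩ := h
    simp [he.extend_apply]
  · simp [Function.extend_apply' _ _ _ h]

theorem cf_lift_embed_mono {V : Matrix κ κ R} {e : κ → ι} (he : e.Injective)
    {S T : ι → ℕ} (hT : ∀ i, i ∉ Set.range e → T i = S i) :
    cf T (lift (embed V e) (mono R S)) = cf (T ∘ e) (lift V (mono R (S ∘ e))) := by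
  conv_lhs => rw [← extend_comp_self he S]
  rw [← insert_mono he, lift_embed_insert V he, cf_insert he hT]

end Embed

/-! ### Polynomials without certain monomials -/

/-- The polynomials none of whose monomials has exponents in `G`. -/
def vanishing (R : Type*) [CommRing R] (G : (ι → ℕ) → Prop) : Submodule R (MvPolynomial ι R) :=
  ⨅ (t : ι → ℕ) (_ : G t), LinearMap.ker (cf t)

theorem mem_vanishing {G : (ι → ℕ) → Prop} {f : MvPolynomial ι R} :
    f ∈ vanishing R G ↔ ∀ t, G t → cf t f = 0 := by
  simp [vanishing, Submodule.mem_iInf]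

/-- Only monomials `S` with a nonzero transition to `T` contribute to the coefficient at `T`. For
`T` in `G'` these lie in `G`, where `f` has no coefficient. Conditions imposed on the final state
are thereby pulled back through the gates. -/
theorem lift_mem_vanishing {G G' : (ι → ℕ) → Prop} {U : Matrix ι ι R}
    (h : ∀ S T, G' T → cf T (lift U (mono R S)) ≠ 0 → G S) {f : MvPolynomial ι R}
    (hf : f ∈ vanishing R G) : lift U f ∈ vanishing R G' := by
  rw [mem_vanishing] at hf ⊢
  intro T hT
  rw [f.as_sum, map_sum, map_sum]
  apply Finset.sum_eq_zero
  intro S _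
  have h1 : monomial S (coeff S f) = coeff S f • mono R (S : ι → ℕ) := by
    rw [mono, smul_monomial, smul_eq_mul, mul_one]
    congr 2
    ext; simp
  rw [h1, map_smul, map_smul, smul_eq_mul]
  by_cases h0 : cf T (lift U (mono R (S : ι → ℕ))) = 0
  · rw [h0, mul_zero]
  · have := hf _ (h _ _ hT h0)
    rw [cf, lcoeff_apply] at this
    rw [show S = Finsupp.equivFunOnFinite.symm (S : ι → ℕ) by ext; simp, this, zero_mul]

/-- Exponents that disagree with `u` off the range never occur in an inserted polynomial; for the
others the coefficient is one of `g`. -/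
theorem insert_mem_vanishing [DecidableEq ι] [DecidableEq κ] {e : κ → ι} (he : e.Injective)
    {G : (ι → ℕ) → Prop} {G' : (κ → ℕ) → Prop} (u : ι → ℕ) (h : ∀ T, G T → G' (T ∘ e))
    {g : MvPolynomial κ R} (hg : g ∈ vanishing R G') : insert e u g ∈ vanishing R G := by
  rw [mem_vanishing] at hg ⊢
  intro T hT
  by_cases hu : ∀ i, i ∉ Set.range e → T i = u i
  · rw [cf_insert he hu, hg _ (h T hT)]
  · push Not at hu
    obtain ⟨i, hi, hne⟩ := hu
    rw [g.as_sum, map_sum, map_sum]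
    apply Finset.sum_eq_zero
    intro S _
    have h1 : monomial S (coeff S g) = coeff S g • mono R (S : κ → ℕ) := by
      rw [mono, smul_monomial, smul_eq_mul, mul_one]
      congr 2
      ext; simp
    rw [h1, map_smul, map_smul, insert_mono he, cf_mono, if_neg, smul_zero]
    rintro rfl
    exact hne (Function.extend_apply' _ _ _ hi)

/-- The step repeated for every gate: the error already present is transported, and the gate's own
error on the ideal state `g` is added. -/
theorem lift_sub_mem_vanishing {G G' : (ι → ℕ) → Prop} {U : Matrix ι ι R}
    (h : ∀ S T, G' T → cf T (lift U (mono R S)) ≠ 0 → G S) {f g g' : MvPolynomial ι R}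
    (hf : f - g ∈ vanishing R G) (hg : lift U g - g' ∈ vanishing R G') :
    lift U f - g' ∈ vanishing R G' := by
  have := add_mem (lift_mem_vanishing h hf) hg
  rwa [map_sub, sub_add_sub_cancel] at this

end Optics

/-! ## The gates on four modes -/

namespace Optics

open MvPolynomial

/-- The linear form with the given coefficients. -/
def form (v : Fin 4 → ℝ) : MvPolynomial (Fin 4) ℝ := ∑ j, v j • X j

theorem cf_X_mul (t : Fin 4 → ℕ) (j : Fin 4) (f : MvPolynomial (Fin 4) ℝ) :
    cf t (X j * f) = if t j = 0 then 0 else cf (Function.update t j (t j - 1)) f := by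
  rw [cf, lcoeff_apply, coeff_X_mul']
  by_cases h : t j = 0
  · simp [h]
  · simp only [Finsupp.mem_support_iff, Finsupp.equivFunOnFinite_symm_apply_apply, ne_eq, h,
      not_false_eq_true, if_true, if_false, cf, lcoeff_apply]
    congr 1
    ext i
    by_cases hi : i = j
    · subst hi; simp
    · simp [hi]

/-- Peeling off one linear factor at a time turns any concrete four-mode amplitude into a finite
computation. -/
theorem cf_form_mul (v : Fin 4 → ℝ) (a b c d : ℕ) (f : MvPolynomial (Fin 4) ℝ) :
    cf ![a, b, c, d] (form v * f) =
      v 0 * (if a = 0 then 0 else cf ![a - 1, b, c, d] f) +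
      v 1 * (if b = 0 then 0 else cf ![a, b - 1, c, d] f) +
      v 2 * (if c = 0 then 0 else cf ![a, b, c - 1, d] f) +
      v 3 * (if d = 0 then 0 else cf ![a, b, c, d - 1] f) := by
  have h0 : Function.update ![a, b, c, d] 0 (a - 1) = ![a - 1, b, c, d] := by
    ext i; fin_cases i <;> rfl
  have h1 : Function.update ![a, b, c, d] 1 (b - 1) = ![a, b - 1, c, d] := by
    ext i; fin_cases i <;> rfl
  have h2 : Function.update ![a, b, c, d] 2 (c - 1) = ![a, b, c - 1, d] := by
    ext i; fin_cases i <;> rfl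
  have h3 : Function.update ![a, b, c, d] 3 (d - 1) = ![a, b, c, d - 1] := by
    ext i; fin_cases i <;> rfl
  rw [form, Fin.sum_univ_four]
  simp only [add_mul, map_add, smul_mul_assoc, map_smul, smul_eq_mul, cf_X_mul]
  simp [h0, h1, h2, h3]

theorem cf_one_zero : cf ![0, 0, 0, 0] (1 : MvPolynomial (Fin 4) ℝ) = 1 := by
  have : (1 : MvPolynomial (Fin 4) ℝ) = mono ℝ ![0, 0, 0, 0] := by
    simp [mono_eq_prod, Fin.prod_univ_four]
  rw [this, cf_mono, if_pos rfl]

theorem lift_mono_four (V : Matrix (Fin 4) (Fin 4) ℝ) (a b c d : ℕ) :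
    lift V (mono ℝ ![a, b, c, d]) =
      form (fun j => V j 0) ^ a * (form (fun j => V j 1) ^ b * (form (fun j => V j 2) ^ c *
        (form (fun j => V j 3) ^ d * 1))) := by
  rw [mono_eq_prod, Fin.prod_univ_four]
  simp [form, mul_assoc]

theorem eq_vec_four (t : Fin 4 → ℕ) : t = ![t 0, t 1, t 2, t 3] := by
  ext i; fin_cases i <;> rfl

/-- The occupation numbers of the four modes of a qubit in state `|b⟩`. -/
def live (b : Fin 2) : Fin 4 → ℕ := if b = 0 then ![1, 0, 2, 1] else ![0, 1, 2, 1]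

/-! ### The encoder -/

/-- A beam splitter on modes 1 and 2. -/
def encoder : Matrix (Fin 4) (Fin 4) ℝ :=
  !![1, 0, 0, 0; 0, √2 / 2, √2 / 2, 0; 0, √2 / 2, -(√2 / 2), 0; 0, 0, 0, 1]

theorem encoder_mul_transpose : encoder * encoder.transpose = 1 := by
  have h : √2 * √2 = 2 := Real.mul_self_sqrt (by norm_num)
  ext i j
  fin_cases i <;> fin_cases j <;>
    simp [encoder, Matrix.mul_apply, Fin.sum_univ_four, -Real.mul_self_sqrt] <;> grind

/-- Two photons meeting on a balanced beam splitter bunch: `x₁x₂` becomes `(x₁ + x₂)(x₁ - x₂)/2`,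
without a mixed term. The `x₂²` part is `live 0`; the `x₁²` part has 0 and 1 photons in modes 2 and
3. -/
theorem lift_encoder : lift encoder (mono ℝ ![1, 1, 1, 1]) - (-1 / 2 : ℝ) • mono ℝ (live 0) ∈
    vanishing ℝ (fun t => ¬ (t 2 = 0 ∧ t 3 = 1)) := by
  have h : √2 * √2 = 2 := Real.mul_self_sqrt (by norm_num)
  have key : lift encoder (mono ℝ ![1, 1, 1, 1]) - (-1 / 2 : ℝ) • mono ℝ (live 0) =
      (1 / 2 : ℝ) • mono ℝ ![1, 2, 0, 1] := by
    have hC : (C (√2 / 2) : MvPolynomial (Fin 4) ℝ) * C (√2 / 2) = C (1 / 2) := by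
      rw [← C_mul]; congr 1; linear_combination h / 4
    have hn : (C (-1 / 2) : MvPolynomial (Fin 4) ℝ) = - C (1 / 2) := by
      rw [← C_neg]; congr 1; norm_num
    rw [lift_mono_four]
    simp [form, mono_eq_prod, Fin.sum_univ_four, Fin.prod_univ_four, encoder, live]
    simp only [smul_eq_C_mul, hn]
    have hi : (C 2⁻¹ : MvPolynomial (Fin 4) ℝ) = C (1 / 2) := by norm_num
    simp only [hi]
    linear_combination (X 0 * (X 1 + X 2) * (X 1 - X 2) * X 3) * hC
  rw [key, mem_vanishing]
  intro t ht
  rw [map_smul, cf_mono, if_neg, smul_zero]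
  rintro rfl
  exact ht ⟨rfl, rfl⟩

/-! ### Single-qubit gates -/

/-- A `2 × 2` matrix on modes 0 and 1. -/
def qubitRotation (G : Matrix (Fin 2) (Fin 2) ℝ) : Matrix (Fin 4) (Fin 4) ℝ :=
  !![G 0 0, G 0 1, 0, 0; G 1 0, G 1 1, 0, 0; 0, 0, 1, 0; 0, 0, 0, 1]

theorem rotation_mul_transpose {G : Matrix (Fin 2) (Fin 2) ℝ} (hG : G * G.transpose = 1) :
    qubitRotation G * (qubitRotation G).transpose = 1 := by
  have h : ∀ i j, (G * G.transpose) i j = (1 : Matrix (Fin 2) (Fin 2) ℝ) i j := by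
    intro i j; rw [hG]
  simp only [Matrix.mul_apply, Fin.sum_univ_two, Matrix.transpose_apply] at h
  have h00 := h 0 0
  have h01 := h 0 1
  have h10 := h 1 0
  have h11 := h 1 1
  simp only [Matrix.one_apply] at h00 h01 h10 h11
  ext i j
  fin_cases i <;> fin_cases j <;>
    simp [qubitRotation, Matrix.mul_apply, Fin.sum_univ_four] <;> simpa

theorem lift_rotation (G : Matrix (Fin 2) (Fin 2) ℝ) (b : Fin 2) :
    lift (qubitRotation G) (mono ℝ (live b)) = ∑ c, G c b • mono ℝ (live c) := by
  fin_cases b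
  · simp only [live, Fin.zero_eta, if_true]
    rw [lift_mono_four]
    simp [form, mono_eq_prod, Fin.sum_univ_four, Fin.prod_univ_four, qubitRotation, Fin.sum_univ_two,
      add_mul, mul_assoc]
  · simp only [live, Fin.mk_one, one_ne_zero, if_false]
    rw [lift_mono_four]
    simp [form, mono_eq_prod, Fin.sum_univ_four, Fin.prod_univ_four, qubitRotation, Fin.sum_univ_two,
      add_mul, mul_assoc]

theorem rotation_conserves (G : Matrix (Fin 2) (Fin 2) ℝ) {s t : Fin 4 → ℕ}
    (h : cf t (lift (qubitRotation G) (mono ℝ s)) ≠ 0) : t 2 = s 2 ∧ t 3 = s 3 := by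
  constructor <;> refine eq_of_cf_ne_zero _ _ ?_ h <;> intro j hj <;> fin_cases j <;>
    simp_all [qubitRotation]

/-! ### The decoder -/

/-- The matrix of the decoder. -/
def decoder : Matrix (Fin 4) (Fin 4) ℝ :=
  !![1, 0, 0, 0; 0, √3 / 3, √2 / 2, √6 / 6; 0, √3 / 3, -(√2 / 2), √6 / 6;
    0, √3 / 3, 0, -(√6 / 3)]

theorem decoder_mul_transpose : decoder * decoder.transpose = 1 := by
  have h2 : √2 * √2 = 2 := Real.mul_self_sqrt (by norm_num)
  have h3 : √3 * √3 = 3 := Real.mul_self_sqrt (by norm_num)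
  have h6 : √6 * √6 = 6 := Real.mul_self_sqrt (by norm_num)
  ext i j
  fin_cases i <;> fin_cases j <;>
    simp [decoder, Matrix.mul_apply, Fin.sum_univ_four, -Real.mul_self_sqrt] <;> grind

/-- For `live 0`, `x₂²` contributes `-x₁x₂` and `x₃` contributes `-(√6 / 3)x₃`. For `live 1` mode 0
is empty and the decoder does not couple to it, so `x₀x₁x₂x₃` cannot appear. -/
theorem cf_decoder_live (b : Fin 2) :
    cf ![1, 1, 1, 1] (lift decoder (mono ℝ (live b))) = if b = 0 then √6 / 3 else 0 := by
  have h2 : √2 * √2 = 2 := Real.mul_self_sqrt (by norm_num)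
  fin_cases b
  · simp only [live, Fin.zero_eta, if_true]
    rw [lift_mono_four]
    simp only [pow_two, pow_one, pow_zero, one_mul, mul_assoc, cf_form_mul]
    simp [cf_one_zero, decoder]
    grind
  · simp only [live, Fin.mk_one, one_ne_zero, if_false]
    rw [lift_mono_four]
    simp only [pow_two, pow_one, pow_zero, one_mul, mul_assoc, cf_form_mul]
    simp [cf_one_zero, decoder]

/-- Conservation in mode 0 and of the photon number leave only `s = (1, 2, 0, 1)`. There the
coefficient of `x₁x₂x₃` in a multiple of `(x₁ + x₂ + x₃)²(x₁ + x₂ - 2x₃)` is proportional to `1 + 1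
- 2`. -/
theorem cf_decoder_eq_zero {s : Fin 4 → ℕ} (h2 : s 2 = 0) (h3 : s 3 = 1) :
    cf ![1, 1, 1, 1] (lift decoder (mono ℝ s)) = 0 := by
  by_contra h
  have h0 : (1 : ℕ) = s 0 := by
    refine eq_of_cf_ne_zero (t := ![1, 1, 1, 1]) _ 0 ?_ h
    intro j hj; fin_cases j <;> simp_all [decoder]
  have hs := sum_eq_of_cf_ne_zero _ h
  simp [Fin.sum_univ_four, h2, h3, ← h0] at hs
  have h1 : s 1 = 2 := by omega
  have : s = ![1, 2, 0, 1] := by rw [eq_vec_four s, ← h0, h1, h2, h3]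
  rw [this, lift_mono_four] at h
  apply h
  simp only [pow_two, pow_one, pow_zero, one_mul, mul_assoc, cf_form_mul]
  simp [cf_one_zero, decoder]
  ring

/-! ### The controlled sign gate -/

/-- Knill's matrix: post-selected on one photon in each of the modes 2 and 3, before and after, it
acts as a controlled sign gate on modes 0 and 1. -/
def knill : Matrix (Fin 4) (Fin 4) ℝ :=
  !![-(1 / 3), -(√2 / 3), √2 / 3, 2 / 3;
    √2 / 3, -(1 / 3), -(2 / 3), √2 / 3;
    -(√(3 + √6) / 3), √(3 - √6) / 3, -(√2 * √(3 + √6) / 6), √2 * √(3 - √6) / 6;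
    -(√(3 - √6) / 3), -(√(3 + √6) / 3), -(√2 * √(3 - √6) / 6), -(√2 * √(3 + √6) / 6)]

/-- These relations suffice for all computations with `knill` once the four radicals are replaced by
unknowns. The last one comes from `(3 + √6)(3 - √6) = 3`. -/
theorem knill_relations : √2 * √2 = 2 ∧ √(3 + √6) * √(3 + √6) = 3 + √6 ∧
    √(3 - √6) * √(3 - √6) = 3 - √6 ∧ √6 * √6 = 6 ∧ 2 * (√(3 + √6) * √(3 - √6)) = √2 * √6 := by
  have h6 : √6 * √6 = 6 := Real.mul_self_sqrt (by norm_num)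
  have h0 := Real.sqrt_nonneg 6
  refine ⟨Real.mul_self_sqrt (by norm_num), Real.mul_self_sqrt (by positivity),
    Real.mul_self_sqrt (by nlinarith), h6, ?_⟩
  rw [← Real.sqrt_mul (by positivity), ← Real.sqrt_mul (by norm_num),
    show (3 + √6) * (3 - √6) = 3 by linear_combination -h6, show (2 * 6 : ℝ) = 2 ^ 2 * 3 by norm_num,
    Real.sqrt_mul (by norm_num), Real.sqrt_sq (by norm_num)]

theorem knill_mul_transpose : knill * knill.transpose = 1 := by
  obtain ⟨h1, h2, h3, h4, h5⟩ := knill_relations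
  unfold knill
  generalize √(3 + √6) = a at *
  generalize √(3 - √6) = b at *
  generalize √6 = s at *
  generalize √2 = r at *
  ext i j
  fin_cases i <;> fin_cases j <;>
    simp [Matrix.mul_apply, Fin.sum_univ_four] <;> grind

/-- A finite check. Besides the diagonal values, it includes the bunched outputs `(2, 0)` and `(0,
2)` from `(1, 1)`, whose amplitudes must vanish. -/
theorem cf_knill_of_sum {a b c d : ℕ} (hc : c ≤ 1) (hd : d ≤ 1) (h : a + b = c + d) :
    cf ![a, b, 1, 1] (lift knill (mono ℝ ![c, d, 1, 1])) =
      if a = c ∧ b = d then √6 / 9 * (if c = 1 ∧ d = 1 then -1 else 1) else 0 := by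
  obtain ⟨h1, h2, h3, h4, h5⟩ := knill_relations
  unfold knill
  generalize √(3 + √6) = u at *
  generalize √(3 - √6) = v at *
  generalize √6 = s at *
  generalize √2 = r at *
  rw [lift_mono_four]
  have ha : a ≤ 2 := by omega
  have hb : b ≤ 2 := by omega
  interval_cases c <;> interval_cases d <;> interval_cases a <;> interval_cases b <;>
    first
    | (exfalso; revert h; decide)
    | (simp only [pow_one, pow_zero, one_mul, cf_form_mul]
       simp [cf_one_zero]
       grind)

/-- Outputs with a different number of photons in modes 0 and 1 violate photon conservation; the
others are covered by `cf_knill_of_sum`. -/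
theorem lift_knill {c d : ℕ} (hc : c ≤ 1) (hd : d ≤ 1) :
    lift knill (mono ℝ ![c, d, 1, 1]) -
        (√6 / 9 * (if c = 1 ∧ d = 1 then -1 else 1)) • mono ℝ ![c, d, 1, 1] ∈
      vanishing ℝ (fun t => t 2 = 1 ∧ t 3 = 1) := by
  rw [mem_vanishing]
  rintro t ⟨ht2, ht3⟩
  rw [map_sub, map_smul, cf_mono, eq_vec_four t, ht2, ht3]
  by_cases h : t 0 + t 1 = c + d
  · rw [cf_knill_of_sum hc hd h]
    by_cases h' : t 0 = c ∧ t 1 = d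
    · simp [h'.1, h'.2]
    · have hne : ![c, d, 1, 1] ≠ ![t 0, t 1, 1, 1] := by
        intro he
        exact h' ⟨(congrFun he 0).symm, (congrFun he 1).symm⟩
      rw [if_neg h', if_neg hne]
      simp
  · have h1 : cf ![t 0, t 1, 1, 1] (lift knill (mono ℝ ![c, d, 1, 1])) = 0 := by
      by_contra h0
      have := sum_eq_of_cf_ne_zero _ h0
      simp [Fin.sum_univ_four] at this
      omega
    have hne : ![c, d, 1, 1] ≠ ![t 0, t 1, 1, 1] := by
      intro he
      have h2 := congrFun he 0
      have h3 := congrFun he 1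
      simp at h2 h3
      omega
    rw [h1, if_neg hne]
    simp

end Optics

/-! ## Simulation of qubit circuits -/

namespace Optics

open MvPolynomial

variable {n Γ : ℕ}

/-- The modes: four for every qubit, two for every controlled sign gate. -/
abbrev Mode (n Γ : ℕ) : Type := (Fin n × Fin 4) ⊕ (Fin Γ × Fin 2)

/-- The four modes of a qubit. -/
def qubitModes (q : Fin n) : Fin 4 → Mode n Γ := fun r => Sum.inl (q, r)

/-- The four modes on which a controlled sign gate acts. -/
def csignModes (i j : Fin n) (k : Fin Γ) : Fin 4 → Mode n Γ :=
  ![Sum.inl (i, 1), Sum.inl (j, 1), Sum.inr (k, 0), Sum.inr (k, 1)]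

theorem qubitModes_injective (q : Fin n) : (qubitModes (Γ := Γ) q).Injective := by
  intro r s h
  simpa [qubitModes] using h

theorem csignModes_injective {i j : Fin n} (hij : i ≠ j) (k : Fin Γ) :
    (csignModes i j k).Injective := by
  intro r s h
  fin_cases r <;> fin_cases s <;> simp_all [csignModes, eq_comm]

/-- Occupation numbers `y` in the modes of the qubits, and `1` in all helper modes. -/
def exps (y : Fin n → Fin 4 → ℕ) : Mode n Γ → ℕ := Sum.elim (fun p => y p.1 p.2) fun _ => 1

theorem extend_qubitModes (y : Fin n → Fin 4 → ℕ) (q : Fin n) (t : Fin 4 → ℕ) :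
    Function.extend (qubitModes q) t (exps (Γ := Γ) y) = exps (Function.update y q t) := by
  funext i
  by_cases h : i ∈ Set.range (qubitModes (Γ := Γ) q)
  · obtain ⟨r, rfl⟩ := h
    rw [(qubitModes_injective q).extend_apply]
    simp [qubitModes, exps]
  · rw [Function.extend_apply' _ _ _ h]
    rcases i with ⟨q', r⟩ | i
    · have : q' ≠ q := by rintro rfl; exact h ⟨r, rfl⟩
      simp [exps, this]
    · rfl

/-- The occupation numbers satisfy `P` on every qubit, and there is one photon in each of the modes
of the first `h` helper pairs. -/
def Good (P : Fin n → (Fin 4 → ℕ) → Prop) (h : ℕ) (S : Mode n Γ → ℕ) : Prop :=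
  (∀ q, P q (S ∘ qubitModes q)) ∧ ∀ k : Fin Γ, (k : ℕ) < h → ∀ b, S (Sum.inr (k, b)) = 1

/-- Other qubits and all helper modes keep their occupations, so only the condition at `q` has to be
pulled back, through `V` itself. -/
theorem good_of_qubit_gate {V : Matrix (Fin 4) (Fin 4) ℝ} {q : Fin n}
    {P P' : Fin n → (Fin 4 → ℕ) → Prop} {h : ℕ} (hP : ∀ q', q' ≠ q → ∀ s, P' q' s → P q' s)
    (hq : ∀ s t, P' q t → cf t (lift V (mono ℝ s)) ≠ 0 → P q s) (S T : Mode n Γ → ℕ)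
    (hT : Good P' h T) (hST : cf T (lift (embed V (qubitModes q)) (mono ℝ S)) ≠ 0) :
    Good P h S := by
  have hoff := eq_off_of_cf_lift_embed_ne_zero (qubitModes_injective q) hST
  rw [cf_lift_embed_mono (qubitModes_injective q) hoff] at hST
  refine ⟨fun q' => ?_, fun k hk b => ?_⟩
  · by_cases hqq : q' = q
    · subst hqq
      exact hq _ _ (hT.1 q') hST
    · have : S ∘ qubitModes q' = T ∘ qubitModes q' := by
        funext r
        refine (hoff (qubitModes q' r) ?_).symm
        rintro ⟨r', hr'⟩
        simp [qubitModes] at hr'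
        exact hqq hr'.1.symm
      rw [this]
      exact hP q' hqq _ (hT.1 q')
  · rw [← hoff, hT.2 k hk b]
    rintro ⟨r', hr'⟩
    simp [qubitModes] at hr'

theorem qubit_gate_mono {V : Matrix (Fin 4) (Fin 4) ℝ} {q : Fin n}
    {P' : Fin n → (Fin 4 → ℕ) → Prop} {h : ℕ} {y : Fin n → Fin 4 → ℕ} {a : ℝ} {t : Fin 4 → ℕ}
    (hV : lift V (mono ℝ (y q)) - a • mono ℝ t ∈ vanishing ℝ (P' q)) :
    lift (embed V (qubitModes q)) (mono ℝ (exps (Γ := Γ) y)) -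
      a • mono ℝ (exps (Function.update y q t)) ∈ vanishing ℝ (Good P' h) := by
  have h1 := insert_mem_vanishing (qubitModes_injective q) (G := Good (Γ := Γ) P' h) (exps y)
    (fun T hT => hT.1 q) hV
  rw [map_sub, map_smul, insert_mono (qubitModes_injective q), extend_qubitModes,
    ← lift_embed_insert _ (qubitModes_injective q), insert_mono (qubitModes_injective q),
    extend_qubitModes, Function.update_eq_self] at h1
  exact h1

/-- What remains of the state space of a qubit: the occupation numbers of modes 2 and 3 of its
modes are not `0` and `1`. -/
def Live (s : Fin 4 → ℕ) : Prop := ¬ (s 2 = 0 ∧ s 3 = 1)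

/-! ### Encoding -/

/-- The state `f` is the encoded zero state on the first `k` qubits and `1, …, 1` elsewhere. -/
def Encoded (k : ℕ) (f : MvPolynomial (Mode n Γ) ℝ) : Prop :=
  f - (-1 / 2 : ℝ) ^ k • mono ℝ (exps fun q : Fin n => if q < k then live 0 else ![1, 1, 1, 1]) ∈
    vanishing ℝ (Good (fun q s => (q : ℕ) < k → Live s) 0)

theorem exps_ones : exps (fun _ : Fin n => ![1, 1, 1, 1]) = fun _ : Mode n Γ => 1 := by
  funext i
  rcases i with ⟨q, r⟩ | i
  · fin_cases r <;> rfl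
  · rfl

theorem encoded_zero : Encoded 0 (mono ℝ fun _ : Mode n Γ => 1) := by
  have : (mono ℝ fun _ : Mode n Γ => 1) - (-1 / 2 : ℝ) ^ 0 • mono ℝ
      (exps fun q : Fin n => if (q : ℕ) < 0 then live 0 else ![1, 1, 1, 1]) = 0 := by
    simp [exps_ones]
  rw [Encoded, this]
  exact zero_mem _

theorem Encoded.step {f : MvPolynomial (Mode n Γ) ℝ} {q : Fin n} (hf : Encoded (q : ℕ) f) :
    Encoded (q + 1) (lift (embed encoder (qubitModes q)) f) := by
  refine lift_sub_mem_vanishing (good_of_qubit_gate ?_ ?_) hf ?_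
  · intro q' hq' s hs hlt
    exact hs (by omega)
  -- Before its encoder acts, qubit `q` carries no condition, since `q < q` is false.
  · intro s t _ _ hlt
    exact absurd hlt (lt_irrefl _)
  · have h1 : (fun q' : Fin n => if (q' : ℕ) < q + 1 then live 0 else ![1, 1, 1, 1]) =
        Function.update (fun q' : Fin n => if (q' : ℕ) < q then live 0 else ![1, 1, 1, 1]) q
          (live 0) := by
      funext q'
      by_cases hq : q' = q
      · subst hq; simp
      · have : ((q' : ℕ) < q + 1) ↔ (q' : ℕ) < q := by
          have := Fin.val_ne_of_ne hq
          omega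
        simp [hq, this]
    rw [h1, pow_succ, mul_smul, map_smul, ← smul_sub]
    apply Submodule.smul_mem
    apply qubit_gate_mono
    simp only [lt_irrefl, if_false]
    have h2 := lift_encoder
    rw [mem_vanishing] at h2 ⊢
    exact fun t ht => h2 t (ht (Nat.lt_succ_self _))

/-! ### Gates -/

/-- The state `f` is the encoded state `ψ`, where the first `h` helper pairs have been used. -/
def Encodes (h : ℕ) (ψ : (Fin n → Fin 2) → ℝ) (f : MvPolynomial (Mode n Γ) ℝ) : Prop :=
  f - ∑ x, ψ x • mono ℝ (exps fun q => live (x q)) ∈ vanishing ℝ (Good (fun _ => Live) h)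

theorem Encoded.encodes {f : MvPolynomial (Mode n Γ) ℝ} (hf : Encoded n f) :
    Encodes 0 (fun x => (-1 / 2 : ℝ) ^ n * if x = 0 then 1 else 0) f := by
  unfold Encodes
  unfold Encoded at hf
  simpa using hf

/-- The real form of the operator of a gate. -/
def act : QubitCircuit.Gate n → ((Fin n → Fin 2) → ℝ) → (Fin n → Fin 2) → ℝ
  | .single q G, ψ => fun x => ∑ b, G.1 (x q) b * ψ (Function.update x q b)
  | .csign i j _, ψ => fun x => (if x i = 1 ∧ x j = 1 then -1 else 1) * ψ x

/-- Exchanging `c` with the `q`-th bit of `x` is an involution on pairs. It turns the sum over where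
each basis state goes into a sum over where each amplitude comes from. -/
theorem sum_update_swap {M : Type*} [AddCommMonoid M] (q : Fin n)
    (F : (Fin n → Fin 2) → Fin 2 → M) :
    ∑ x, ∑ c, F x c = ∑ x, ∑ b, F (Function.update x q b) (x q) := by
  rw [← Fintype.sum_prod_type', ← Fintype.sum_prod_type'
    (f := fun x b => F (Function.update x q b) (x q))]
  have hinv : Function.Involutive
      fun p : (Fin n → Fin 2) × Fin 2 => (Function.update p.1 q p.2, p.1 q) := by
    rintro ⟨x, c⟩
    simp
  exact (Equiv.sum_comp hinv.toPerm fun p : (Fin n → Fin 2) × Fin 2 => F p.1 p.2).symm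

theorem Encodes.single {h : ℕ} {ψ : (Fin n → Fin 2) → ℝ} {f : MvPolynomial (Mode n Γ) ℝ}
    (hf : Encodes h ψ f) (q : Fin n) (G : Matrix.orthogonalGroup (Fin 2) ℝ) :
    Encodes h (act (.single q G) ψ) (lift (embed (qubitRotation G.1) (qubitModes q)) f) := by
  refine lift_sub_mem_vanishing (good_of_qubit_gate ?_ ?_) hf ?_
  · exact fun _ _ _ hs => hs
  · intro s t ht hst
    obtain ⟨h2, h3⟩ := rotation_conserves _ hst
    rwa [Live, ← h2, ← h3]
  · have h1 : ∀ x : Fin n → Fin 2, lift (embed (qubitRotation G.1) (qubitModes q))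
        (mono ℝ (exps (Γ := Γ) fun q => live (x q))) =
        ∑ c, G.1 c (x q) • mono ℝ (exps fun q' => live (Function.update x q c q')) := by
      intro x
      have h2 : ∀ c, (fun q' => live (Function.update x q c q')) =
          Function.update (fun q => live (x q)) q (live c) := by
        intro c
        funext q'
        by_cases hq : q' = q
        · subst hq; simp
        · simp [hq]
      have h3 := lift_embed_insert (qubitRotation G.1) (qubitModes_injective (Γ := Γ) q)
        (exps fun q => live (x q)) (mono ℝ (live (x q)))
      rw [insert_mono (qubitModes_injective q), extend_qubitModes, lift_rotation, map_sum] at h3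
      simp only [map_smul, insert_mono (qubitModes_injective q), extend_qubitModes] at h3
      rw [Function.update_eq_self_iff.2 rfl] at h3
      simp only [h2]
      exact h3
    rw [map_sum]
    simp only [map_smul, h1, Finset.smul_sum, smul_smul]
    rw [sum_update_swap q]
    simp only [act, Finset.sum_smul, Function.update_self, Function.update_idem,
      Function.update_eq_self, mul_comm, sub_self, zero_mem]

/-- Among qubit modes only modes 1 are touched, so `Live` is unaffected. Helper pair `k` is mixed by
the gate, so its condition holds only afterwards: `k + 1` drops to `k`. -/
theorem good_of_csign {i j : Fin n} (hij : i ≠ j) (k : Fin Γ) (S T : Mode n Γ → ℕ)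
    (hT : Good (fun _ => Live) (k + 1) T)
    (hST : cf T (lift (embed knill (csignModes i j k)) (mono ℝ S)) ≠ 0) :
    Good (fun _ => Live) k S := by
  have hoff := eq_off_of_cf_lift_embed_ne_zero (csignModes_injective hij k) hST
  refine ⟨fun q => ?_, fun k' hk b => ?_⟩
  · have h : ∀ r : Fin 4, r ≠ 1 → T (qubitModes q r) = S (qubitModes q r) := by
      intro r hr
      apply hoff
      rintro ⟨r', hr'⟩
      fin_cases r' <;> simp_all [csignModes, qubitModes, eq_comm]
    have := hT.1 q
    simp only [Live, Function.comp_apply] at this ⊢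
    rwa [← h 2 (by decide), ← h 3 (by decide)]
  · rw [← hoff, hT.2 k' (by omega) b]
    rintro ⟨r', hr'⟩
    have hne : k ≠ k' := by rintro rfl; exact lt_irrefl _ hk
    fin_cases r' <;> simp_all [csignModes]

theorem Encodes.csign {k : Fin Γ} {ψ : (Fin n → Fin 2) → ℝ} {f : MvPolynomial (Mode n Γ) ℝ}
    (hf : Encodes (k : ℕ) ψ f) {i j : Fin n} (hij : i ≠ j) :
    Encodes (k + 1) (fun x => √6 / 9 * act (.csign i j hij) ψ x)
      (lift (embed knill (csignModes i j k)) f) := by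
  refine lift_sub_mem_vanishing (good_of_csign hij k) hf ?_
  rw [map_sum, ← Finset.sum_sub_distrib]
  apply sum_mem
  intro x _
  -- The value of a qubit is the occupation of its mode 1, so the sign depends exactly on the two
  -- modes fed to `knill`.
  have hv : ∀ b : Fin 2, live b 1 = b := by intro b; fin_cases b <;> rfl
  have hs : exps (fun q => live (x q)) ∘ csignModes i j k = ![(x i : ℕ), (x j : ℕ), 1, 1] := by
    funext r
    fin_cases r <;> simp [csignModes, exps, hv]
  have h1 := insert_mem_vanishing (csignModes_injective hij k)
    (G := Good (fun _ => Live) (k + 1)) (exps fun q => live (x q))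
    (fun T hT => ⟨hT.2 k (Nat.lt_succ_self _) 0, hT.2 k (Nat.lt_succ_self _) 1⟩)
    (lift_knill (c := x i) (d := x j) (by omega) (by omega))
  rw [map_sub, map_smul, ← lift_embed_insert _ (csignModes_injective hij k),
    insert_mono (csignModes_injective hij k), ← hs,
    extend_comp_self (csignModes_injective hij k)] at h1
  have h2 := Submodule.smul_mem _ (ψ x) h1
  rw [smul_sub, smul_smul] at h2
  have h3 : √6 / 9 * act (.csign i j hij) ψ x =
      ψ x * (√6 / 9 * if (x i : ℕ) = 1 ∧ (x j : ℕ) = 1 then -1 else 1) := by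
    have : ∀ b : Fin 2, (b : ℕ) = 1 ↔ b = 1 := by decide
    simp only [act, this]
    ring
  rw [map_smul]
  beta_reduce
  rw [h3]
  exact h2

/-! ### Decoding -/

open Classical in
/-- The state `ψ`, projected to zero on the first `k` qubits. -/
def project (k : ℕ) (ψ : (Fin n → Fin 2) → ℝ) (x : Fin n → Fin 2) : ℝ :=
  if ∀ q : Fin n, (q : ℕ) < k → x q = 0 then ψ x else 0

/-- The state `f` is the encoded state `ψ`, projected to zero on the first `k` qubits. -/
def Decoded (k : ℕ) (ψ : (Fin n → Fin 2) → ℝ) (f : MvPolynomial (Mode n Γ) ℝ) : Prop :=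
  f - ∑ x : Fin n → Fin 2, ((√6 / 3) ^ k * project k ψ x) •
      mono ℝ (exps fun q => if (q : ℕ) < k then ![1, 1, 1, 1] else live (x q)) ∈
    vanishing ℝ (Good (fun q s => if (q : ℕ) < k then s = ![1, 1, 1, 1] else Live s) Γ)

theorem Encodes.decoded {ψ : (Fin n → Fin 2) → ℝ} {f : MvPolynomial (Mode n Γ) ℝ}
    (hf : Encodes Γ ψ f) : Decoded 0 ψ f := by
  unfold Decoded
  unfold Encodes at hf
  simpa [project] using hf

theorem Decoded.step {ψ : (Fin n → Fin 2) → ℝ} {f : MvPolynomial (Mode n Γ) ℝ} {q : Fin n}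
    (hf : Decoded (q : ℕ) ψ f) :
    Decoded (q + 1) ψ (lift (embed decoder (qubitModes q)) f) := by
  have hlt : ∀ q' : Fin n, q' ≠ q → (((q' : ℕ) < q + 1) ↔ (q' : ℕ) < q) := by
    intro q' hq
    have := Fin.val_ne_of_ne hq
    omega
  refine lift_sub_mem_vanishing (good_of_qubit_gate ?_ ?_) hf ?_
  · intro q' hq' s hs
    simpa only [hlt q' hq'] using hs
  · intro s t ht hst
    simp only [Nat.lt_succ_self, if_true] at ht
    simp only [lt_irrefl, if_false]
    -- The unwanted branch of the encoder dies here: it has no amplitude on `1, 1, 1, 1`.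
    rintro ⟨h2, h3⟩
    rw [ht, cf_decoder_eq_zero h2 h3] at hst
    exact hst rfl
  · rw [map_sum, ← Finset.sum_sub_distrib]
    apply sum_mem
    intro x _
    have h1 : (fun q' : Fin n => if (q' : ℕ) < q + 1 then ![1, 1, 1, 1] else live (x q')) =
        Function.update (fun q' : Fin n => if (q' : ℕ) < q then ![1, 1, 1, 1] else live (x q')) q
          ![1, 1, 1, 1] := by
      funext q'
      by_cases hq : q' = q
      · subst hq; simp
      · simp [hq, hlt q' hq]
    have h2 : project (q + 1) ψ x = project q ψ x * if x q = 0 then 1 else 0 := by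
      have : (∀ q' : Fin n, (q' : ℕ) < q + 1 → x q' = 0) ↔
          (∀ q' : Fin n, (q' : ℕ) < q → x q' = 0) ∧ x q = 0 := by
        refine ⟨fun h => ⟨fun q' hq' => h q' (by omega), h q (Nat.lt_succ_self _)⟩, ?_⟩
        rintro ⟨ha, hb⟩ q' hq'
        by_cases hq : q' = q
        · rw [hq, hb]
        · exact ha q' ((hlt q' hq).1 hq')
      simp only [project, this]
      by_cases ha : ∀ q' : Fin n, (q' : ℕ) < q → x q' = 0 <;> by_cases hb : x q = 0 <;>
        simp [hb]
    rw [h1, h2, pow_succ]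
    -- The projection onto `x q = 0` is absorbed into the decoder's amplitude, which is zero for
    -- `live 1`.
    rw [show (√6 / 3) ^ (q : ℕ) * (√6 / 3) * (project q ψ x * if x q = 0 then 1 else 0) =
      ((√6 / 3) ^ (q : ℕ) * project q ψ x) * (if x q = 0 then √6 / 3 else 0) by
        split_ifs <;> ring,
      mul_smul ((√6 / 3) ^ (q : ℕ) * project q ψ x), map_smul, ← smul_sub]
    apply Submodule.smul_mem
    apply qubit_gate_mono
    simp only [lt_irrefl, if_false, Nat.lt_succ_self, if_true]
    rw [mem_vanishing]
    rintro t rfl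
    rw [map_sub, cf_decoder_live, map_smul, cf_mono, if_pos rfl]
    simp

theorem Decoded.cf_eq {ψ : (Fin n → Fin 2) → ℝ} {f : MvPolynomial (Mode n Γ) ℝ}
    (hf : Decoded n ψ f) : cf (fun _ => 1) f = (√6 / 3) ^ n * ψ 0 := by
  unfold Decoded at hf
  rw [mem_vanishing] at hf
  have h1 := hf (fun _ => 1) ⟨fun q => ?_, fun _ _ _ => rfl⟩
  · rw [map_sub, sub_eq_zero] at h1
    rw [h1, map_sum, Finset.sum_eq_single 0]
    · simp [exps_ones, cf_mono, project]
    · intro x _ hx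
      rw [project, if_neg]
      · simp
      · intro h
        exact hx (funext fun q => h q q.2)
    · simp
  · simp only [q.2, if_true]
    funext r
    fin_cases r <;> rfl

/-! ### The amplitude -/

/-- The real form of the operator of a circuit, applied to the zero state. -/
def evolve (Q : QubitCircuit.Circuit n) : (Fin n → Fin 2) → ℝ :=
  Q.foldl (fun ψ g => act g ψ) (Pi.single 0 1)

theorem toMatrix_mulVec (g : QubitCircuit.Gate n) (ψ : (Fin n → Fin 2) → ℝ) :
    g.toMatrix.mulVec (fun x => (ψ x : ℂ)) = fun x => ((act g ψ x : ℝ) : ℂ) := by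
  funext x
  cases g with
  | csign i j hij =>
    simp only [QubitCircuit.Gate.toMatrix, Matrix.mulVec_diagonal, act]
    push_cast
    split_ifs <;> simp
  | single q G =>
    simp only [QubitCircuit.Gate.toMatrix, act, Matrix.mulVec, dotProduct, Matrix.of_apply]
    push_cast
    simp only [ite_mul, zero_mul]
    rw [← Finset.sum_filter]
    symm
    -- The columns with a nonzero entry in row `x` agree with `x` off `q`, hence are the updates of
    -- `x` at `q`.
    refine Finset.sum_bij (fun b _ => Function.update x q b) ?_ ?_ ?_ ?_
    · intro b _
      simp only [Finset.mem_filter, Finset.mem_univ, true_and]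
      intro k hk
      simp [hk]
    · intro b _ b' _ h
      simpa using congrFun h q
    · intro y hy
      simp only [Finset.mem_filter, Finset.mem_univ, true_and] at hy
      refine ⟨y q, Finset.mem_univ _, ?_⟩
      funext k
      by_cases hk : k = q
      · subst hk; simp
      · simp [hk, hy k hk]
    · intro b _
      simp

theorem zeroAmplitude_eq (Q : QubitCircuit.Circuit n) : Q.zeroAmplitude = (evolve Q 0 : ℝ) := by
  have h : ∀ (Q : QubitCircuit.Circuit n) (ψ : (Fin n → Fin 2) → ℝ),
      (QubitCircuit.Circuit.toMatrix Q).mulVec (fun x => (ψ x : ℂ)) =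
        fun x => ((Q.foldl (fun ψ g => act g ψ) ψ x : ℝ) : ℂ) := by
    intro Q
    induction Q with
    | nil => intro ψ; simp [QubitCircuit.Circuit.toMatrix]
    | cons g gs ih =>
      intro ψ
      rw [QubitCircuit.Circuit.toMatrix, ← Matrix.mulVec_mulVec, toMatrix_mulVec, ih]
      rfl
  have h1 := congrFun (h Q (Pi.single 0 1)) 0
  have h2 : (fun x : Fin n → Fin 2 => (((Pi.single 0 1 : (Fin n → Fin 2) → ℝ) x : ℝ) : ℂ)) =
      Pi.single 0 1 := by
    funext x
    by_cases hx : x = 0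
    · subst hx; simp
    · simp [hx]
  rw [h2, Matrix.mulVec_single_one] at h1
  exact h1

/-! ### Fock amplitudes as polynomial coefficients -/

theorem fockInner_monomial {m : ℕ} (S : Fin m →₀ ℕ) (f : LinearOptics.FockSpace m) :
    LinearOptics.fockInner (monomial S 1) f = LinearOptics.occFactorial S * coeff S f := by
  rw [LinearOptics.fockInner, support_monomial, if_neg one_ne_zero]
  simp

/-- All factorials are 1 for single occupation, so the amplitude is a coefficient; what remains is
renaming the modes and passing from real to complex scalars. -/
theorem amplitude_allOnes {N : ℕ} (M : Matrix (Mode n Γ) (Mode n Γ) ℝ) (e : Mode n Γ ≃ Fin N) :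
    LinearOptics.amplitude ((M.reindex e e).map fun x : ℝ => (x : ℂ))
      (LinearOptics.allOnes _) (LinearOptics.allOnes _) =
        (cf (fun _ => 1) (lift M (mono ℝ fun _ => 1)) : ℝ) := by
  have h1 : LinearOptics.occFactorial (LinearOptics.allOnes N) = 1 := by
    simp [LinearOptics.occFactorial, LinearOptics.allOnes]
  have h2 : LinearOptics.fockState (LinearOptics.allOnes N) =
      monomial (LinearOptics.allOnes N) 1 := by
    simp [LinearOptics.fockState, h1]
  have h3 : LinearOptics.phi ((M.reindex e e).map fun x : ℝ => (x : ℂ))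
      (monomial (LinearOptics.allOnes N) 1) =
      rename e (map (algebraMap ℝ ℂ) (lift M (mono ℝ fun _ => 1))) := by
    have h4 : (monomial (LinearOptics.allOnes N) 1 : MvPolynomial (Fin N) ℂ) = ∏ i, X i := by
      have := mono_eq_prod (R := ℂ) (fun _ : Fin N => 1)
      simpa [mono, LinearOptics.allOnes] using this
    rw [h4, mono_eq_prod, LinearOptics.phi, AlgHom.toLinearMap_apply, map_prod, map_prod, map_prod,
      map_prod, ← Equiv.prod_comp e]
    apply Finset.prod_congr rfl
    intro i _
    rw [aeval_X, pow_one, lift_X, map_sum, map_sum, ← Equiv.sum_comp e]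
    apply Finset.sum_congr rfl
    intro j _
    simp [smul_eq_C_mul]
  have h5 : LinearOptics.allOnes N =
      (Finsupp.equivFunOnFinite.symm fun _ : Mode n Γ => 1).mapDomain e := by
    rw [equivFunOnFinite_symm_mapDomain e.injective]
    ext i
    have : i = e (e.symm i) := by simp
    rw [this]
    simp [LinearOptics.allOnes]
  rw [LinearOptics.amplitude, h2, fockInner_monomial, h1, h3, h5,
    coeff_rename_mapDomain _ e.injective, coeff_map]
  simp [cf]

end Optics

/-! ## Correctness and running time of programs -/

namespace RealMachine

variable {inp : Input}

/-- Started in state `s`, the program stops after at most `t` steps in a state with property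
`Q`. -/
def Program.Spec (P : Program) (inp : Input) (s : State) (t : ℕ) (Q : State → Prop) : Prop :=
  Q (P.run inp s).1 ∧ (P.run inp s).2 ≤ t

theorem Program.Spec.mono {P : Program} {s : State} {t t' : ℕ} {Q Q' : State → Prop}
    (h : P.Spec inp s t Q) (ht : t ≤ t') (hQ : ∀ s', Q s' → Q' s') : P.Spec inp s t' Q' :=
  ⟨hQ _ h.1, h.2.trans ht⟩

theorem Program.Spec.seq {P P' : Program} {s : State} {t t' : ℕ} {Q Q' : State → Prop}
    (h : P.Spec inp s t Q) (h' : ∀ s', Q s' → P'.Spec inp s' t' Q') :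
    (Program.seq P P').Spec inp s (t + t') Q' :=
  ⟨(h' _ h.1).1, Nat.add_le_add h.2 (h' _ h.1).2⟩

theorem Program.Spec.instr {a : Instr} {s : State} {Q : State → Prop} (h : Q (a.exec inp s)) :
    (Program.instr a).Spec inp s 1 Q :=
  ⟨h, le_rfl⟩

theorem Program.Spec.ifEq {P P' : Program} {r r' : ℕ} {s : State} {t : ℕ} {Q : State → Prop}
    (h : s.reg r = s.reg r' → P.Spec inp s t Q) (h' : s.reg r ≠ s.reg r' → P'.Spec inp s t Q) :
    (Program.ifEq r r' P P').Spec inp s (t + 1) Q := by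
  by_cases hr : s.reg r = s.reg r'
  · simpa [Program.Spec, Program.run, hr] using h hr
  · simpa [Program.Spec, Program.run, hr] using h' hr

/-- The number of rounds is fixed on entry, so `I` need not preserve register `r`. -/
theorem Program.Spec.loop {P : Program} {r : ℕ} {s : State} {t c : ℕ} (hc : s.reg r = c)
    (I : ℕ → State → Prop) (h0 : I 0 s)
    (h : ∀ k < c, ∀ s', I k s' → P.Spec inp s' t (I (k + 1))) :
    (Program.loop r P).Spec inp s (1 + c * (t + 1)) (I c) := by
  have key : ∀ k ≤ c, I k ((fun u : State × ℕ =>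
      ((P.run inp u.1).1, u.2 + (P.run inp u.1).2 + 1))^[k] (s, 1)).1 ∧
      ((fun u : State × ℕ => ((P.run inp u.1).1, u.2 + (P.run inp u.1).2 + 1))^[k] (s, 1)).2 ≤
        1 + k * (t + 1) := by
    intro k
    induction k with
    | zero => intro _; simpa using h0
    | succ k ih =>
      intro hk
      obtain ⟨h1, h2⟩ := ih (by omega)
      rw [Function.iterate_succ_apply']
      obtain ⟨h3, h4⟩ := h k (by omega) _ h1
      refine ⟨h3, ?_⟩
      simp only
      rw [Nat.succ_mul]
      omega
  rw [Program.Spec, Program.run, hc]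
  exact key c le_rfl

/-- A straight-line program. -/
def Program.block : List Instr → Program
  | [] => .instr (.copy 0 0)
  | a :: l => .seq (.instr a) (Program.block l)

/-- The effect of a list of instructions. -/
def execs (inp : Input) (l : List Instr) (s : State) : State :=
  l.foldl (fun s a => a.exec inp s) s

theorem execs_append (l l' : List Instr) (s : State) :
    execs inp (l ++ l') s = execs inp l' (execs inp l s) := List.foldl_append

theorem block_run (l : List Instr) (s : State) :
    (Program.block l).run inp s = (execs inp l s, l.length + 1) := by
  induction l generalizing s with
  | nil => simp [Program.block, Program.run, Instr.exec, State.setReg, execs]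
  | cons a l ih => simp [Program.block, Program.run, ih, execs]; omega

theorem Program.Spec.block {l : List Instr} {s : State} {Q : State → Prop}
    (h : Q (execs inp l s)) : (Program.block l).Spec inp s (l.length + 1) Q := by
  rw [Program.Spec, block_run]
  exact ⟨h, le_rfl⟩

/-! ### Applying a four-mode gate to the rows of a matrix

Register 2 holds the size of the matrix, the registers 3 to 7 hold the numbers 0 to 4, and the
registers 10 to 13 hold the four modes. Register 9 runs through the columns, and the row after the
last row of the matrix is used as scratch space. -/

/-- Add a multiple of an entry of the current column to scratch cell `r`; the instruction `c`
multiplies scratch cell 4 by the coefficient. -/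
def accumulate (r q : ℕ) (c : Instr) : List Instr :=
  [.move 2 7 (10 + q) 9, c, .add 2 (3 + r) 2 7]

/-- Compute the new entry in the row of the `r`-th mode in scratch cell `r`. -/
def rowEntry (r : ℕ) (c : ℕ → Instr) : List Instr :=
  .const 2 (3 + r) ⟨0, isAlgebraic_zero⟩ ::
    (accumulate r 0 (c 0) ++ (accumulate r 1 (c 1) ++ (accumulate r 2 (c 2) ++
      accumulate r 3 (c 3))))

/-- Copy the scratch cells to the current column. -/
def writeBack : List Instr :=
  [.move 10 9 2 3, .move 11 9 2 4, .move 12 9 2 5, .move 13 9 2 6]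

/-- Apply the gate to the current column. -/
def column (c : ℕ → ℕ → Instr) : List Instr :=
  rowEntry 0 (c 0) ++ (rowEntry 1 (c 1) ++ (rowEntry 2 (c 2) ++ (rowEntry 3 (c 3) ++ writeBack)))

/-- Apply the gate to all columns. -/
def applyGate (c : ℕ → ℕ → Instr) : Program :=
  .seq (.instr (.clear 9)) (.loop 2 (.seq (.block (column c)) (.instr (.succ 9))))

/-- The registers hold the data needed for applying a gate. -/
structure Ready (reg : ℕ → ℕ) (N : ℕ) (e : Fin 4 → ℕ) : Prop where
  size : reg 2 = N
  num : ∀ r : ℕ, r < 5 → reg (3 + r) = r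
  mode : ∀ r : Fin 4, reg (10 + r) = e r

/-- Given the contents of the registers other than 9, the instruction multiplies scratch cell 4
by `v`. -/
def Scales (inp : Input) (reg : ℕ → ℕ) (a : Instr) (v : ℝ) : Prop :=
  ∀ s : State, (∀ r, r ≠ 9 → s.reg r = reg r) → a.exec inp s = s.setCell 2 7 (v * s.cell 2 7)

theorem accumulate_spec {s : State} {N : ℕ} {e : Fin 4 → ℕ} {reg : ℕ → ℕ} {a : Instr} {v : ℝ}
    (hs : Ready s.reg N e) (hreg : ∀ r, r ≠ 9 → s.reg r = reg r) (ha : Scales inp reg a v)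
    {r : ℕ} (hr : r < 4) (q : Fin 4) :
    (execs inp (accumulate r q a) s).reg = s.reg ∧
    (execs inp (accumulate r q a) s).mem N r = s.mem N r + v * s.mem (e q) (s.reg 9) ∧
    ∀ i j, ¬ (i = N ∧ (j = r ∨ j = 4)) →
      (execs inp (accumulate r q a) s).mem i j = s.mem i j := by
  have h2 := hs.size
  have h7 : s.reg 7 = 4 := hs.num 4 (by norm_num)
  have hr3 : s.reg (3 + r) = r := hs.num r (by omega)
  have hq' := hs.mode q
  have h1 := ha (Instr.exec inp (.move 2 7 (10 + q) 9) s) hreg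
  have h3 : execs inp (accumulate r q a) s =
      Instr.exec inp (.add 2 (3 + r) 2 7) (a.exec inp (Instr.exec inp (.move 2 7 (10 + q) 9) s)) :=
    rfl
  rw [h3, h1]
  refine ⟨rfl, ?_, ?_⟩
  · simp [Instr.exec, State.setCell, State.cell, h2, h7, hr3, hq', hr.ne]
  · intro i j hij
    simp only [Instr.exec, State.setCell, State.cell, h2, h7, hr3, hq']
    rw [if_neg (fun h => hij ⟨h.1, Or.inl h.2⟩), if_neg (fun h => hij ⟨h.1, Or.inr h.2⟩),
      if_neg (fun h => hij ⟨h.1, Or.inr h.2⟩)]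

theorem rowEntry_spec {s : State} {N : ℕ} {e : Fin 4 → ℕ} {reg : ℕ → ℕ} {c : ℕ → Instr}
    {v : Fin 4 → ℝ} (hs : Ready s.reg N e) (hreg : ∀ r, r ≠ 9 → s.reg r = reg r)
    (hc : ∀ q : Fin 4, Scales inp reg (c q) (v q)) {r : ℕ} (hr : r < 4) (he : ∀ q, e q < N) :
    (execs inp (rowEntry r c) s).reg = s.reg ∧
    (execs inp (rowEntry r c) s).mem N r = ∑ q, v q * s.mem (e q) (s.reg 9) ∧
    ∀ i j, ¬ (i = N ∧ (j = r ∨ j = 4)) → (execs inp (rowEntry r c) s).mem i j = s.mem i j := by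
  -- The entries being read lie in rows below `N`, so writes to the scratch row never corrupt them.
  have hrow : ∀ q, ¬ (e q = N ∧ (s.reg 9 = r ∨ s.reg 9 = 4)) := fun q h => (he q).ne h.1
  set s0 := Instr.exec inp (.const 2 (3 + r) ⟨0, isAlgebraic_zero⟩) s with hs0
  have h3 : execs inp (rowEntry r c) s = execs inp (accumulate r 0 (c 0) ++
      (accumulate r 1 (c 1) ++ (accumulate r 2 (c 2) ++ accumulate r 3 (c 3)))) s0 := rfl
  have hr3 : s.reg (3 + r) = r := hs.num r (by omega)
  have g0 : s0.reg = s.reg := rfl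
  have m0 : s0.mem N r = 0 := by simp [hs0, Instr.exec, State.setCell, hs.size, hr3]
  have o0 : ∀ i j, ¬ (i = N ∧ (j = r ∨ j = 4)) → s0.mem i j = s.mem i j := by
    intro i j hij
    simp only [hs0, Instr.exec, State.setCell, hs.size, hr3]
    rw [if_neg fun h => hij ⟨h.1, Or.inl h.2⟩]
  rw [h3, execs_append, execs_append, execs_append]
  obtain ⟨g1, m1, o1⟩ := accumulate_spec (s := s0) (g0 ▸ hs) (g0 ▸ hreg) (hc 0) hr 0
  set s1 := execs inp (accumulate r (0 : Fin 4) (c (0 : Fin 4))) s0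
  rw [g0] at g1 m1
  obtain ⟨g2, m2, o2⟩ := accumulate_spec (s := s1) (g1 ▸ hs) (g1 ▸ hreg) (hc 1) hr 1
  set s2 := execs inp (accumulate r (1 : Fin 4) (c (1 : Fin 4))) s1
  rw [g1] at g2 m2
  obtain ⟨g3, m3, o3⟩ := accumulate_spec (s := s2) (g2 ▸ hs) (g2 ▸ hreg) (hc 2) hr 2
  set s3 := execs inp (accumulate r (2 : Fin 4) (c (2 : Fin 4))) s2
  rw [g2] at g3 m3
  obtain ⟨g4, m4, o4⟩ := accumulate_spec (s := s3) (g3 ▸ hs) (g3 ▸ hreg) (hc 3) hr 3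
  set s4 := execs inp (accumulate r (3 : Fin 4) (c (3 : Fin 4))) s3
  rw [g3] at g4 m4
  refine ⟨g4, ?_, ?_⟩
  · refine m4.trans ?_
    rw [m3, m2, m1, m0, o3 _ _ (hrow 3), o2 _ _ (hrow 3), o1 _ _ (hrow 3), o0 _ _ (hrow 3),
      o2 _ _ (hrow 2), o1 _ _ (hrow 2), o0 _ _ (hrow 2), o1 _ _ (hrow 1), o0 _ _ (hrow 1),
      o0 _ _ (hrow 0), Fin.sum_univ_four, zero_add]
  · intro i j hij
    exact (o4 i j hij).trans (by rw [o3 i j hij, o2 i j hij, o1 i j hij, o0 i j hij])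

/-- Each new entry depends on all four old ones, so all are computed in scratch cells before any is
written back. The scratch row is spoiled, hence the restriction `i < N`. -/
theorem column_spec {s : State} {N : ℕ} {e : Fin 4 → ℕ} {reg : ℕ → ℕ} {c : ℕ → ℕ → Instr}
    {V : Matrix (Fin 4) (Fin 4) ℝ} (hs : Ready s.reg N e)
    (hreg : ∀ r, r ≠ 9 → s.reg r = reg r)
    (hc : ∀ r q : Fin 4, Scales inp reg (c r q) (V r q)) (he : ∀ q, e q < N)
    (hinj : e.Injective) :
    (execs inp (column c) s).reg = s.reg ∧
    (∀ r, (execs inp (column c) s).mem (e r) (s.reg 9) =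
      ∑ q, V r q * s.mem (e q) (s.reg 9)) ∧
    ∀ i j, i < N → ¬ ((∃ r, i = e r) ∧ j = s.reg 9) →
      (execs inp (column c) s).mem i j = s.mem i j := by
  rw [column, execs_append, execs_append, execs_append, execs_append]
  obtain ⟨g1, m1, o1⟩ := rowEntry_spec (s := s) hs hreg (v := fun q => V 0 q) (hc 0)
    (r := 0) (by norm_num) he
  set s1 := execs inp (rowEntry 0 (c 0)) s
  replace g1 : s1.reg = s.reg := g1
  obtain ⟨g2, m2, o2⟩ := rowEntry_spec (s := s1) (g1 ▸ hs) (g1 ▸ hreg) (v := fun q => V 1 q) (hc 1)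
    (r := 1) (by norm_num) he
  set s2 := execs inp (rowEntry 1 (c 1)) s1
  replace g2 : s2.reg = s.reg := g2.trans g1
  obtain ⟨g3, m3, o3⟩ := rowEntry_spec (s := s2) (g2 ▸ hs) (g2 ▸ hreg) (v := fun q => V 2 q) (hc 2)
    (r := 2) (by norm_num) he
  set s3 := execs inp (rowEntry 2 (c 2)) s2
  replace g3 : s3.reg = s.reg := g3.trans g2
  obtain ⟨g4, m4, o4⟩ := rowEntry_spec (s := s3) (g3 ▸ hs) (g3 ▸ hreg) (v := fun q => V 3 q) (hc 3)
    (r := 3) (by norm_num) he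
  set s4 := execs inp (rowEntry 3 (c 3)) s3
  replace g4 : s4.reg = s.reg := g4.trans g3
  replace o1 : ∀ i j, ¬ (i = N ∧ (j = 0 ∨ j = 4)) → s1.mem i j = s.mem i j := o1
  replace o2 : ∀ i j, ¬ (i = N ∧ (j = 1 ∨ j = 4)) → s2.mem i j = s1.mem i j := o2
  replace o3 : ∀ i j, ¬ (i = N ∧ (j = 2 ∨ j = 4)) → s3.mem i j = s2.mem i j := o3
  replace o4 : ∀ i j, ¬ (i = N ∧ (j = 3 ∨ j = 4)) → s4.mem i j = s3.mem i j := o4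
  replace m1 : s1.mem N 0 = _ := m1
  replace m2 : s2.mem N 1 = _ := m2
  replace m3 : s3.mem N 2 = _ := m3
  replace m4 : s4.mem N 3 = _ := m4
  have p1 : ∀ i j, i ≠ N → s1.mem i j = s.mem i j := fun i j hi => o1 i j fun h => hi h.1
  have p2 : ∀ i j, i ≠ N → s2.mem i j = s.mem i j := fun i j hi =>
    (o2 i j fun h => hi h.1).trans (p1 i j hi)
  have p3 : ∀ i j, i ≠ N → s3.mem i j = s.mem i j := fun i j hi =>
    (o3 i j fun h => hi h.1).trans (p2 i j hi)
  have p4 : ∀ i j, i ≠ N → s4.mem i j = s.mem i j := fun i j hi =>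
    (o4 i j fun h => hi h.1).trans (p3 i j hi)
  have n0 : s4.mem N 0 = ∑ q, V 0 q * s.mem (e q) (s.reg 9) := by
    rw [o4 N 0 (by omega), o3 N 0 (by omega), o2 N 0 (by omega), m1]
  have n1 : s4.mem N 1 = ∑ q, V 1 q * s.mem (e q) (s.reg 9) := by
    rw [o4 N 1 (by omega), o3 N 1 (by omega), m2, g1]
    exact Finset.sum_congr rfl fun q _ => by rw [p1 _ _ (he q).ne]
  have n2 : s4.mem N 2 = ∑ q, V 2 q * s.mem (e q) (s.reg 9) := by
    rw [o4 N 2 (by omega), m3, g2]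
    exact Finset.sum_congr rfl fun q _ => by rw [p2 _ _ (he q).ne]
  have n3 : s4.mem N 3 = ∑ q, V 3 q * s.mem (e q) (s.reg 9) := by
    rw [m4, g3]
    exact Finset.sum_congr rfl fun q _ => by rw [p3 _ _ (he q).ne]
  have r2 : s4.reg 2 = N := g4 ▸ hs.size
  have r3 : s4.reg 3 = 0 := g4 ▸ hs.num 0 (by norm_num)
  have r4 : s4.reg 4 = 1 := g4 ▸ hs.num 1 (by norm_num)
  have r5 : s4.reg 5 = 2 := g4 ▸ hs.num 2 (by norm_num)
  have r6 : s4.reg 6 = 3 := g4 ▸ hs.num 3 (by norm_num)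
  have r9 : s4.reg 9 = s.reg 9 := by rw [g4]
  have r10 : s4.reg 10 = e 0 := g4 ▸ hs.mode 0
  have r11 : s4.reg 11 = e 1 := g4 ▸ hs.mode 1
  have r12 : s4.reg 12 = e 2 := g4 ▸ hs.mode 2
  have r13 : s4.reg 13 = e 3 := g4 ▸ hs.mode 3
  -- No write-back hits a scratch cell that is still to be read.
  have hN : ∀ q, N ≠ e q := fun q => (he q).ne'
  have hmem : (execs inp writeBack s4).mem = fun i j =>
      if i = e 3 ∧ j = s.reg 9 then s4.mem N 3 else
      if i = e 2 ∧ j = s.reg 9 then s4.mem N 2 else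
      if i = e 1 ∧ j = s.reg 9 then s4.mem N 1 else
      if i = e 0 ∧ j = s.reg 9 then s4.mem N 0 else s4.mem i j := by
    simp [execs, writeBack, Instr.exec, State.setCell, State.cell, r2, r3, r4, r5, r6, r9, r10,
      r11, r12, r13, hN]
  refine ⟨g4, ?_, ?_⟩
  · intro r
    rw [hmem]
    have hd : ∀ a b : Fin 4, e a = e b ↔ a = b := fun a b => hinj.eq_iff
    fin_cases r <;> simp [hd, n0, n1, n2, n3]
  · intro i j hi hij
    rw [hmem]
    have hj : ∀ q, ¬ (i = e q ∧ j = s.reg 9) := fun q h => hij ⟨⟨q, h.1⟩, h.2⟩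
    simp only [hj, if_false]
    exact p4 i j hi.ne

theorem applyGate_spec {s : State} {N : ℕ} {e : Fin 4 → ℕ} {c : ℕ → ℕ → Instr}
    {V : Matrix (Fin 4) (Fin 4) ℝ} (hs : Ready s.reg N e)
    (hc : ∀ r q : Fin 4, Scales inp s.reg (c r q) (V r q)) (he : ∀ q, e q < N)
    (hinj : e.Injective) :
    (applyGate c).Spec inp s (2 + 59 * N) fun s' =>
      (∀ r, r ≠ 9 → s'.reg r = s.reg r) ∧
      (∀ r j, j < N → s'.mem (e r) j = ∑ q, V r q * s.mem (e q) j) ∧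
      ∀ i j, i < N → (∀ r, i ≠ e r) → s'.mem i j = s.mem i j := by
  have hR : ∀ s' : State, (∀ r, r ≠ 9 → s'.reg r = s.reg r) → Ready s'.reg N e := by
    intro s' h
    refine ⟨by rw [h _ (by norm_num), hs.size], ?_, ?_⟩
    · intro r hr; rw [h _ (by omega), hs.num r hr]
    · intro r; rw [h _ (by omega), hs.mode r]
  -- The block `column c` has `4 * 13 + 4 = 56` instructions and costs 57 steps, one more than its
  -- length.
  refine ((Program.Spec.instr (Q := fun s' => s' = s.setReg 9 0) rfl).seq ?_).mono
    (t := 1 + (1 + N * (57 + 1 + 1))) (by omega) fun s' h => h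
  rintro s0 rfl
  refine (Program.Spec.loop (c := N) (by simp [State.setReg, hs.size]) (fun k s' =>
    s'.reg 9 = k ∧ (∀ r, r ≠ 9 → s'.reg r = s.reg r) ∧
    (∀ r j, s'.mem (e r) j = if j < k then ∑ q, V r q * s.mem (e q) j else s.mem (e r) j) ∧
    ∀ i j, i < N → (∀ r, i ≠ e r) → s'.mem i j = s.mem i j) ?_ ?_).mono le_rfl ?_
  · refine ⟨by simp [State.setReg], fun r hr => by simp [State.setReg, hr], ?_, ?_⟩ <;>
      simp [State.setReg]
  · rintro k - s' ⟨h9, hreg, hm, ho⟩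
    refine (Program.Spec.block (Q := fun s'' => s'' = execs inp (column c) s') rfl).seq ?_
    rintro _ rfl
    obtain ⟨g, m, o⟩ := column_spec (hR s' hreg) hreg hc he hinj
    apply Program.Spec.instr
    refine ⟨by simp [Instr.exec, State.setReg, g, h9], ?_, ?_, ?_⟩
    · intro r hr
      simp [Instr.exec, State.setReg, g, hr, hreg r hr]
    · intro r j
      simp only [Instr.exec, State.setReg]
      by_cases hj : j = k
      · subst hj
        rw [← h9, m, h9, if_pos (Nat.lt_succ_self _)]
        exact Finset.sum_congr rfl fun q _ => by rw [hm, if_neg (lt_irrefl _)]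
      · rw [o _ _ (he r) (by rw [h9]; exact fun h => hj h.2), hm]
        have : j < k + 1 ↔ j < k := by omega
        simp only [this]
    · intro i j hi hie
      simp only [Instr.exec, State.setReg]
      rw [o i j hi (fun h => by obtain ⟨r, hr⟩ := h.1; exact hie r hr), ho i j hi hie]
  · rintro s' ⟨-, hreg, hm, ho⟩
    exact ⟨hreg, fun r j hj => by rw [hm, if_pos hj], ho⟩

/-! ### Addressing the modes of a qubit -/

/-- Load the four modes of the qubit in register `r`. -/
def loadQubit (r : ℕ) : Program :=
  .seq (.instr (.clear 10)) (.seq (.loop r (.block [.succ 10, .succ 10, .succ 10, .succ 10]))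
    (.block [.copy 11 10, .succ 11, .copy 12 11, .succ 12, .copy 13 12, .succ 13]))

/-- Integers cannot be multiplied, so `4q` is reached by counting; this is the source of the cost `6
* s.reg r`. -/
theorem loadQubit_spec {s : State} {r : ℕ} (hr : r < 10 ∨ 13 < r) :
    (loadQubit r).Spec inp s (9 + 6 * s.reg r) fun s' => s'.mem = s.mem ∧
      (∀ i, i < 10 ∨ 13 < i → s'.reg i = s.reg i) ∧
      ∀ k : Fin 4, s'.reg (10 + k) = 4 * s.reg r + k := by
  refine ((Program.Spec.instr (Q := fun s' => s' = s.setReg 10 0) rfl).seq ?_).mono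
    (t := 1 + ((1 + s.reg r * (5 + 1)) + 7)) (by omega) fun s' h => h
  rintro s0 rfl
  refine (Program.Spec.loop (c := s.reg r) (by
    simp only [State.setReg]; rw [Function.update_of_ne (by omega)]) (fun k s' =>
    s'.mem = s.mem ∧ (∀ i, i < 10 ∨ 13 < i → s'.reg i = s.reg i) ∧ s'.reg 10 = 4 * k) ?_ ?_).seq ?_
  · refine ⟨rfl, ?_, by simp [State.setReg]⟩
    intro i hi
    simp only [State.setReg]
    rw [Function.update_of_ne (by omega)]
  · rintro k - s' ⟨h1, h2, h3⟩
    apply Program.Spec.block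
    refine ⟨h1, ?_, ?_⟩
    · intro i hi
      have : i ≠ 10 := by omega
      simp [execs, Instr.exec, State.setReg, this, h2 i hi]
    · simp [execs, Instr.exec, State.setReg, h3]
      ring
  · rintro s' ⟨h1, h2, h3⟩
    apply Program.Spec.block
    refine ⟨h1, ?_, ?_⟩
    · intro i hi
      have a1 : i ≠ 11 := by omega
      have a2 : i ≠ 12 := by omega
      have a3 : i ≠ 13 := by omega
      simp [execs, Instr.exec, State.setReg, a1, a2, a3, h2 i hi]
    · intro k
      fin_cases k <;> simp [execs, Instr.exec, State.setReg, h3]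

end RealMachine

/-! ## The compiler -/

namespace Compiler

open RealMachine Optics QubitCircuit MvPolynomial

variable {n Γ : ℕ} {inp : Input}

/-- The number of a mode. -/
def idx : Mode n Γ → ℕ
  | .inl (q, r) => 4 * q + r
  | .inr (k, b) => 4 * n + 2 * k + b

theorem idx_lt (i : Mode n Γ) : idx i < 4 * n + 2 * Γ := by
  rcases i with ⟨q, r⟩ | ⟨k, b⟩ <;> simp only [idx] <;> omega

theorem idx_injective : (idx (n := n) (Γ := Γ)).Injective := by
  rintro (⟨q, r⟩ | ⟨k, b⟩) (⟨q', r'⟩ | ⟨k', b'⟩) h <;> simp only [idx] at h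
  · have h1 : q = q' := Fin.ext (by omega)
    have h2 : r = r' := Fin.ext (by omega)
    rw [h1, h2]
  · omega
  · omega
  · have h1 : k = k' := Fin.ext (by omega)
    have h2 : b = b' := Fin.ext (by omega)
    rw [h1, h2]

/-- The numbering of the modes. -/
def idxEquiv (n Γ : ℕ) : Mode n Γ ≃ Fin (4 * n + 2 * Γ) :=
  Equiv.ofBijective (fun i => ⟨idx i, idx_lt i⟩) <| by
    rw [Fintype.bijective_iff_injective_and_card]
    refine ⟨fun i j h => idx_injective (congrArg Fin.val h), ?_⟩
    simp [mul_comm]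

theorem idxEquiv_apply (i : Mode n Γ) : (idxEquiv n Γ i : ℕ) = idx i := rfl

/-- The memory holds an orthogonal matrix that takes `|1, …, 1⟩` to a state with property `Ψ`. -/
def Holds (s : State) (Ψ : MvPolynomial (Mode n Γ) ℝ → Prop) : Prop :=
  ∃ M : Matrix (Mode n Γ) (Mode n Γ) ℝ, M * M.transpose = 1 ∧
    (∀ i j, s.mem (idx i) (idx j) = M i j) ∧ Ψ (lift M (mono ℝ fun _ => 1))

theorem Holds.congr {s s' : State} {Ψ Ψ' : MvPolynomial (Mode n Γ) ℝ → Prop} (h : Holds s Ψ)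
    (hs : s'.mem = s.mem) (hΨ : ∀ f, Ψ f → Ψ' f) : Holds s' Ψ' := by
  obtain ⟨M, h1, h2, h3⟩ := h
  exact ⟨M, h1, fun i j => by rw [hs, h2], hΨ _ h3⟩

/-- The new matrix is `embed V e * M`, and `lift_mul` turns the row operation into applying the gate
after the circuit built so far. -/
theorem Holds.applyGate {s : State} {Ψ Ψ' : MvPolynomial (Mode n Γ) ℝ → Prop} (h : Holds s Ψ)
    {V : Matrix (Fin 4) (Fin 4) ℝ} (hV : V * V.transpose = 1) {e : Fin 4 → Mode n Γ}
    (he : e.Injective) {c : ℕ → ℕ → Instr} (hs : Ready s.reg (4 * n + 2 * Γ) (idx ∘ e))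
    (hc : ∀ r q : Fin 4, Scales inp s.reg (c r q) (V r q))
    (hΨ : ∀ f, Ψ f → Ψ' (lift (embed V e) f)) :
    (applyGate c).Spec inp s (2 + 59 * (4 * n + 2 * Γ)) fun s' =>
      (∀ r, r ≠ 9 → s'.reg r = s.reg r) ∧ Holds s' Ψ' := by
  obtain ⟨M, h1, h2, h3⟩ := h
  refine (applyGate_spec hs hc (fun q => idx_lt _) (idx_injective.comp he)).mono le_rfl ?_
  rintro s' ⟨hreg, hm, ho⟩
  refine ⟨hreg, embed V e * M, ?_, ?_, ?_⟩
  · rw [Matrix.transpose_mul, Matrix.mul_assoc, ← Matrix.mul_assoc M, h1, Matrix.one_mul,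
      embed_mul_transpose hV he]
  · intro i j
    by_cases hi : i ∈ Set.range e
    · obtain ⟨r, rfl⟩ := hi
      rw [embed_mul_apply_range V he]
      refine (hm r _ (idx_lt j)).trans ?_
      exact Finset.sum_congr rfl fun q _ => by rw [← h2]; rfl
    · rw [embed_mul_apply_off V e M i j hi, ← h2]
      exact ho _ _ (idx_lt i) fun r hr => hi ⟨r, (idx_injective hr).symm⟩
  · rw [lift_mul]
    exact hΨ _ h3

/-- The instructions that multiply by the entries of a fixed matrix. -/
def matrixInstr (V : Matrix (Fin 4) (Fin 4) ℝ) (hV : ∀ i j, IsAlgebraic ℚ (V i j)) (r q : ℕ) :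
    Instr :=
  if h : r < 4 ∧ q < 4 then .scale 2 7 ⟨V ⟨r, h.1⟩ ⟨q, h.2⟩, hV _ _⟩ else .clear 0

theorem scales_matrixInstr (V : Matrix (Fin 4) (Fin 4) ℝ) (hV : ∀ i j, IsAlgebraic ℚ (V i j))
    (reg : ℕ → ℕ) (r q : Fin 4) : Scales inp reg (matrixInstr V hV r q) (V r q) := by
  intro s _
  rw [matrixInstr, dif_pos ⟨r.2, q.2⟩]
  rfl

/-- The instructions that multiply by the entries of the matrix of a single-qubit gate. -/
def rotationInstr (r q : ℕ) : Instr :=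
  if r < 2 ∧ q < 2 then .scaleInput 2 7 8 (3 + (2 * r + q))
  else .scale 2 7 ⟨if r = q then 1 else 0, by
    split_ifs
    exacts [isAlgebraic_one, isAlgebraic_zero]⟩

/-- Register `3 + (2 * r + q)` holds `2 * r + q`, the position of `G r q` in row-by-row order. -/
theorem scales_rotationInstr {G : Matrix (Fin 2) (Fin 2) ℝ} {reg : ℕ → ℕ}
    (hreg : ∀ r : ℕ, r < 5 → reg (3 + r) = r) (h00 : inp.real (reg 8) 0 = G 0 0)
    (h01 : inp.real (reg 8) 1 = G 0 1) (h10 : inp.real (reg 8) 2 = G 1 0)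
    (h11 : inp.real (reg 8) 3 = G 1 1) (r q : Fin 4) :
    Scales inp reg (rotationInstr r q) (qubitRotation G r q) := by
  intro s hs
  have e3 : s.reg 3 = 0 := (hs 3 (by norm_num)).trans (hreg 0 (by norm_num))
  have e4 : s.reg 4 = 1 := (hs 4 (by norm_num)).trans (hreg 1 (by norm_num))
  have e5 : s.reg 5 = 2 := (hs 5 (by norm_num)).trans (hreg 2 (by norm_num))
  have e6 : s.reg 6 = 3 := (hs 6 (by norm_num)).trans (hreg 3 (by norm_num))
  have e8 : s.reg 8 = reg 8 := hs 8 (by norm_num)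
  fin_cases r <;> fin_cases q <;>
    simp [rotationInstr, qubitRotation, Instr.exec, e3, e4, e5, e6, e8, h00, h01, h10, h11]

/-! ### Algebraicity of the constants in the fixed gates -/

theorem isAlgebraic_sqrt {x : ℝ} (hx : IsAlgebraic ℚ x) : IsAlgebraic ℚ √x := by
  rcases le_total 0 x with h | h
  · apply IsAlgebraic.of_pow (n := 2) (by norm_num)
    rwa [Real.sq_sqrt h]
  · rw [Real.sqrt_eq_zero_of_nonpos h]
    exact isAlgebraic_zero

theorem isAlgebraic_ofNat (k : ℕ) [k.AtLeastTwo] : IsAlgebraic ℚ (OfNat.ofNat k : ℝ) := by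
  have := isAlgebraic_natCast (R := ℚ) (A := ℝ) k
  exact_mod_cast this

theorem isAlgebraic_div {x y : ℝ} (hx : IsAlgebraic ℚ x) (hy : IsAlgebraic ℚ y) :
    IsAlgebraic ℚ (x / y) := by
  rw [div_eq_mul_inv]
  exact hx.mul hy.inv

theorem isAlgebraic_encoder (i j : Fin 4) : IsAlgebraic ℚ (encoder i j) := by
  have h := isAlgebraic_div (isAlgebraic_sqrt (isAlgebraic_ofNat 2)) (isAlgebraic_ofNat 2)
  fin_cases i <;> fin_cases j <;>
    simp [encoder, isAlgebraic_zero, isAlgebraic_one, h, h.neg]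

theorem isAlgebraic_decoder (i j : Fin 4) : IsAlgebraic ℚ (decoder i j) := by
  have h2 := isAlgebraic_div (isAlgebraic_sqrt (isAlgebraic_ofNat 2)) (isAlgebraic_ofNat 2)
  have h3 := isAlgebraic_div (isAlgebraic_sqrt (isAlgebraic_ofNat 3)) (isAlgebraic_ofNat 3)
  have h6 := isAlgebraic_div (isAlgebraic_sqrt (isAlgebraic_ofNat 6)) (isAlgebraic_ofNat 6)
  have h6' := isAlgebraic_div (isAlgebraic_sqrt (isAlgebraic_ofNat 6)) (isAlgebraic_ofNat 3)
  fin_cases i <;> fin_cases j <;>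
    simp [decoder, isAlgebraic_zero, isAlgebraic_one, h2, h2.neg, h3, h6, h6'.neg]

theorem isAlgebraic_knill (i j : Fin 4) : IsAlgebraic ℚ (knill i j) := by
  have h3 := isAlgebraic_ofNat 3
  have s2 := isAlgebraic_sqrt (isAlgebraic_ofNat 2)
  have s6 := isAlgebraic_sqrt (isAlgebraic_ofNat 6)
  have a := isAlgebraic_sqrt (h3.add s6)
  have b := isAlgebraic_sqrt (h3.sub s6)
  have k1 : IsAlgebraic ℚ ((3 : ℝ)⁻¹) := h3.inv
  have k2 := isAlgebraic_div (isAlgebraic_ofNat 2) h3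
  have k3 := isAlgebraic_div s2 h3
  have k4 := isAlgebraic_div a h3
  have k5 := isAlgebraic_div b h3
  have k6 := isAlgebraic_div (s2.mul a) (isAlgebraic_ofNat 6)
  have k7 := isAlgebraic_div (s2.mul b) (isAlgebraic_ofNat 6)
  fin_cases i <;> fin_cases j <;>
    simp only [knill, Matrix.of_apply, Matrix.cons_val', Matrix.cons_val, one_div,
      Fin.zero_eta, Fin.mk_one, Fin.reduceFinMk, Matrix.cons_val_zero, Matrix.cons_val_one] <;>
    first
    | exact k1.neg
    | exact k2
    | exact k2.neg
    | exact k3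
    | exact k3.neg
    | exact k4.neg
    | exact k5
    | exact k5.neg
    | exact k6.neg
    | exact k7
    | exact k7.neg

/-- The registers that hold the input sizes, the size of the matrix, and small numbers. -/
structure Frame (reg : ℕ → ℕ) (n L N : ℕ) : Prop where
  qubits : reg 0 = n
  gates : reg 1 = L
  size : reg 2 = N
  num : ∀ r : ℕ, r < 5 → reg (3 + r) = r

theorem Frame.congr {reg reg' : ℕ → ℕ} {n L N : ℕ} (h : Frame reg n L N)
    (h' : ∀ r, r < 8 → reg' r = reg r) : Frame reg' n L N :=
  ⟨by rw [h' _ (by norm_num), h.qubits], by rw [h' _ (by norm_num), h.gates],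
    by rw [h' _ (by norm_num), h.size], fun r hr => by rw [h' _ (by omega), h.num r hr]⟩

/-! ### Sweeping over the qubits -/

/-- Apply a gate to the modes of the qubit in register `r`. -/
def qubitGate (r : ℕ) (c : ℕ → ℕ → Instr) : Program := .seq (loadQubit r) (applyGate c)

/-- The coefficient instructions run after registers 10 to 13 are loaded and while 9 varies, so `hc`
asks for correctness under any registers agreeing with `s` below 9. -/
theorem qubitGate_spec {s : State} {L : ℕ} {Ψ Ψ' : MvPolynomial (Mode n Γ) ℝ → Prop}
    (hF : Frame s.reg n L (4 * n + 2 * Γ)) (h : Holds s Ψ) {V : Matrix (Fin 4) (Fin 4) ℝ}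
    (hV : V * V.transpose = 1) {r : ℕ} (hr : 13 < r) {q : Fin n} (hq : s.reg r = q)
    {c : ℕ → ℕ → Instr}
    (hc : ∀ reg : ℕ → ℕ, (∀ i, i < 9 → reg i = s.reg i) →
      ∀ r q : Fin 4, Scales inp reg (c r q) (V r q))
    (hΨ : ∀ f, Ψ f → Ψ' (lift (embed V (qubitModes q)) f)) :
    (qubitGate r c).Spec inp s ((9 + 6 * n) + (2 + 59 * (4 * n + 2 * Γ))) fun s' =>
      (∀ i, i < 9 ∨ 13 < i → s'.reg i = s.reg i) ∧ Holds s' Ψ' := by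
  refine ((loadQubit_spec (Or.inr hr)).mono ?_ fun s' h' => h').seq ?_
  · rw [hq]; omega
  · rintro s' ⟨hm, hreg, hmode⟩
    refine ((h.congr hm fun _ h => h).applyGate hV (qubitModes_injective q) ?_
      (hc _ fun i hi => hreg i (by omega)) hΨ).mono le_rfl ?_
    · have hF' := hF.congr fun i hi => hreg i (by omega)
      refine ⟨hF'.size, hF'.num, fun r => ?_⟩
      rw [hmode, hq]
      rfl
    · rintro s'' ⟨hreg', h'⟩
      exact ⟨fun i hi => by rw [hreg' i (by omega), hreg i (by omega)], h'⟩

/-- Apply a gate to the modes of every qubit. -/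
def sweep (c : ℕ → ℕ → Instr) : Program :=
  .seq (.instr (.clear 17)) (.loop 0 (.seq (qubitGate 17 c) (.instr (.succ 17))))

theorem sweep_spec {s : State} {L : ℕ} (Ψ : ℕ → MvPolynomial (Mode n Γ) ℝ → Prop)
    (hF : Frame s.reg n L (4 * n + 2 * Γ)) (h : Holds s (Ψ 0)) {V : Matrix (Fin 4) (Fin 4) ℝ}
    (hV : V * V.transpose = 1) {c : ℕ → ℕ → Instr}
    (hc : ∀ (reg : ℕ → ℕ) (r q : Fin 4), Scales inp reg (c r q) (V r q))
    (hΨ : ∀ (q : Fin n) f, Ψ q f → Ψ (q + 1) (lift (embed V (qubitModes q)) f)) :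
    (sweep c).Spec inp s (2 + n * (13 + 6 * n + 59 * (4 * n + 2 * Γ))) fun s' =>
      (∀ i, i < 9 ∨ i = 14 → s'.reg i = s.reg i) ∧ Holds s' (Ψ n) := by
  refine ((Program.Spec.instr (Q := fun s' => s' = s.setReg 17 0) rfl).seq ?_).mono (t := 1 + (1 +
    n * (((9 + 6 * n) + (2 + 59 * (4 * n + 2 * Γ))) + 1 + 1))) (le_of_eq (by ring)) fun _ h => h
  rintro s0 rfl
  refine (Program.Spec.loop (c := n) (by simp [State.setReg, hF.qubits]) (fun k s' =>
    s'.reg 17 = k ∧ (∀ i, i < 9 ∨ i = 14 → s'.reg i = s.reg i) ∧ Holds s' (Ψ k)) ?_ ?_).mono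
    le_rfl fun s' h => h.2
  · refine ⟨by simp [State.setReg], fun i hi => ?_, h.congr rfl fun _ h => h⟩
    simp only [State.setReg]
    rw [Function.update_of_ne (by omega)]
  · rintro k hk s' ⟨h17, hreg, h'⟩
    refine (qubitGate_spec (q := ⟨k, hk⟩) (hF.congr fun i hi => hreg i (by omega)) h' hV
      (by norm_num) h17 (fun reg _ => hc reg) (hΨ ⟨k, hk⟩)).seq ?_
    rintro s'' ⟨hreg', h''⟩
    apply Program.Spec.instr
    refine ⟨by simp [Instr.exec, State.setReg, hreg' 17 (by norm_num), h17], fun i hi => ?_,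
      h''.congr rfl fun _ h => h⟩
    simp only [Instr.exec, State.setReg]
    rw [Function.update_of_ne (by omega), hreg' i (by omega), hreg i hi]

/-! ### The gates of the circuit -/

theorem word_eq {Q : Circuit n} {k : ℕ} {g : Gate n} (hg : Q[k]? = some g) (a : ℕ) :
    Q.toInput.word k a = g.words a := by
  simp [Circuit.toInput, hg]

theorem real_eq {Q : Circuit n} {k : ℕ} {g : Gate n} (hg : Q[k]? = some g) (a : ℕ) :
    Q.toInput.real k a = g.reals a := by
  simp [Circuit.toInput, hg]

/-- The number of controlled sign gates among the first `k` gates. -/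
def used (Q : Circuit n) (k : ℕ) : ℕ := Circuit.csignCount (Q.take k)

theorem take_succ_of_getElem? {Q : Circuit n} {k : ℕ} {g : Gate n} (hg : Q[k]? = some g) :
    Q.take (k + 1) = Q.take k ++ [g] := by
  rw [List.take_add_one, hg]
  rfl

theorem used_succ {Q : Circuit n} {k : ℕ} {g : Gate n} (hg : Q[k]? = some g) :
    used Q (k + 1) = used Q k + if g.isCsign then 1 else 0 := by
  rw [used, take_succ_of_getElem? hg, Circuit.csignCount, List.countP_append,
    List.countP_singleton]
  rfl

theorem used_le (Q : Circuit n) (k : ℕ) : used Q k ≤ Q.csignCount :=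
  (List.take_sublist k Q).countP_le

/-- Lets the factors collected from encoders and controlled sign gates be pulled out of the state in
`Simulates`. -/
theorem act_smul (g : Gate n) (a : ℝ) (ψ : (Fin n → Fin 2) → ℝ) :
    act g (fun x => a * ψ x) = fun x => a * act g ψ x := by
  cases g with
  | single q G =>
    funext x
    simp only [act, Finset.mul_sum]
    exact Finset.sum_congr rfl fun b _ => by ring
  | csign i j hij =>
    funext x
    simp only [act]
    ring

theorem evolve_succ {Q : Circuit n} {k : ℕ} {g : Gate n} (hg : Q[k]? = some g) :
    evolve (Q.take (k + 1)) = act g (evolve (Q.take k)) := by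
  rw [take_succ_of_getElem? hg, evolve, List.foldl_append]
  rfl

/-- The state `f` encodes the state of the qubits after the first `k` gates. -/
def Simulates (Q : Circuit n) (k : ℕ) (f : MvPolynomial (Mode n Γ) ℝ) : Prop :=
  Encodes (used Q k)
    (fun x => ((-1 / 2 : ℝ) ^ n * (√6 / 9) ^ used Q k) * evolve (Q.take k) x) f

theorem Simulates.single {Q : Circuit n} {k : ℕ} {q : Fin n}
    {G : Matrix.orthogonalGroup (Fin 2) ℝ} (hg : Q[k]? = some (.single q G))
    {f : MvPolynomial (Mode n Γ) ℝ} (hf : Simulates Q k f) :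
    Simulates Q (k + 1) (lift (embed (qubitRotation G.1) (qubitModes q)) f) := by
  have h := Encodes.single hf q G
  rw [act_smul, ← evolve_succ hg] at h
  rw [Simulates, used_succ hg]
  exact h

theorem Simulates.csign {Q : Circuit n} {k : ℕ} {i j : Fin n} {hij : i ≠ j}
    (hg : Q[k]? = some (.csign i j hij)) {h : Fin Γ} (hh : (h : ℕ) = used Q k)
    {f : MvPolynomial (Mode n Γ) ℝ} (hf : Simulates Q k f) :
    Simulates Q (k + 1) (lift (embed knill (csignModes i j h)) f) := by
  rw [Simulates, ← hh] at hf
  have h1 := Encodes.csign hf hij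
  rw [act_smul, ← evolve_succ hg] at h1
  have hu : used Q (k + 1) = h + 1 := by
    rw [used_succ hg, hh]
    rfl
  rw [Simulates, hu]
  convert h1 using 2
  ring

/-- Apply the single-qubit gate in register 8. -/
def singleGate : Program := .seq (.instr (.read 16 8 4)) (qubitGate 16 rotationInstr)

/-- Apply the controlled sign gate in register 8, with helper modes from register 14 on. -/
def csignGate : Program :=
  .seq (.instr (.read 16 8 4)) <| .seq (loadQubit 16) <| .seq (.instr (.copy 18 11)) <|
    .seq (.instr (.read 16 8 5)) <| .seq (loadQubit 16) <|
    .seq (.block [.copy 10 18, .copy 12 14, .succ 14, .copy 13 14, .succ 14])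
      (applyGate (matrixInstr knill isAlgebraic_knill))

theorem singleGate_spec {s : State} {Q : Circuit n} {k : ℕ} {q : Fin n}
    {G : Matrix.orthogonalGroup (Fin 2) ℝ} (hg : Q[k]? = some (.single q G))
    (hF : Frame s.reg n Q.length (4 * n + 2 * Γ)) (h8 : s.reg 8 = k)
    (h : Holds (n := n) (Γ := Γ) s (Simulates Q k)) :
    singleGate.Spec Q.toInput s (12 + 6 * n + 59 * (4 * n + 2 * Γ)) fun s' =>
      (∀ i, i < 9 ∨ i = 14 → s'.reg i = s.reg i) ∧
        Holds (n := n) (Γ := Γ) s' (Simulates Q (k + 1)) := by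
  have h4 : s.reg 4 = 1 := hF.num 1 (by norm_num)
  refine ((Program.Spec.instr (Q := fun s' => s' = s.setReg 16 q) ?_).seq ?_).mono
    (t := 1 + ((9 + 6 * n) + (2 + 59 * (4 * n + 2 * Γ)))) (by omega) fun _ h => h
  · rw [Instr.exec, h8, h4, word_eq hg]
    rfl
  rintro s0 rfl
  have hreg : ∀ i, i ≠ 16 → (s.setReg 16 q).reg i = s.reg i := by
    intro i hi
    simp [State.setReg, hi]
  have hV : qubitRotation G.1 * (qubitRotation G.1).transpose = 1 :=
    rotation_mul_transpose ((Matrix.mem_orthogonalGroup_iff (Fin 2) ℝ).1 G.2)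
  refine (qubitGate_spec (q := q) (hF.congr fun i hi => hreg i (by omega))
    (h.congr rfl fun _ h => h) hV (by norm_num) (by simp [State.setReg]) ?_
    fun f hf => hf.single hg).mono le_rfl ?_
  · intro reg hr
    have h8' : reg 8 = k := by rw [hr 8 (by norm_num), hreg 8 (by norm_num), h8]
    apply scales_rotationInstr
    · intro r hr'
      rw [hr _ (by omega), hreg _ (by omega), hF.num r hr']
    all_goals rw [h8', real_eq hg]; rfl
  · rintro s' ⟨h1, h2⟩
    exact ⟨fun i hi => by rw [h1 i (by omega), hreg i (by omega)], h2⟩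

/-- Register 11 receives mode 1 of the loaded qubit. Loading the second qubit overwrites it, so the
first value is saved in register 18. -/
theorem csignGate_spec {s : State} {Q : Circuit n} {k : ℕ} {i j : Fin n} {hij : i ≠ j}
    (hg : Q[k]? = some (.csign i j hij)) {h : Fin Γ} (hh : (h : ℕ) = used Q k)
    (hF : Frame s.reg n Q.length (4 * n + 2 * Γ)) (h8 : s.reg 8 = k)
    (h14 : s.reg 14 = 4 * n + 2 * h) (hs : Holds (n := n) (Γ := Γ) s (Simulates Q k)) :
    csignGate.Spec Q.toInput s (29 + 12 * n + 59 * (4 * n + 2 * Γ)) fun s' =>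
      (∀ i, i < 9 → s'.reg i = s.reg i) ∧ s'.reg 14 = 4 * n + 2 * (h + 1) ∧
        Holds (n := n) (Γ := Γ) s' (Simulates Q (k + 1)) := by
  have h4 : s.reg 4 = 1 := hF.num 1 (by norm_num)
  have h5 : s.reg 5 = 2 := hF.num 2 (by norm_num)
  refine ((Program.Spec.instr (Q := fun s' => s'.mem = s.mem ∧
    (∀ i, i ≠ 16 → s'.reg i = s.reg i) ∧ s'.reg 16 = i) ?_).seq ?_).mono
    (t := 1 + ((9 + 6 * n) + (1 + (1 + ((9 + 6 * n) + (6 + (2 + 59 * (4 * n + 2 * Γ)))))))) (by omega)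
    fun _ h => h
  · rw [Instr.exec, h8, h4, word_eq hg]
    refine ⟨rfl, fun i hi => by simp [State.setReg, hi], by simp [State.setReg, Gate.words]⟩
  rintro s1 ⟨m1, r1, q1⟩
  refine ((loadQubit_spec (Or.inr (by norm_num))).mono (by rw [q1]; omega) fun _ h => h).seq ?_
  rintro s2 ⟨m2, r2, q2⟩
  refine (Program.Spec.instr (Q := fun s' => s'.mem = s.mem ∧
    (∀ i, i < 10 ∨ i = 14 → s'.reg i = s.reg i) ∧ s'.reg 18 = 4 * i + 1) ?_).seq ?_
  · refine ⟨m2.trans m1, fun i hi => ?_, ?_⟩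
    · have : i ≠ 18 := by omega
      simp only [Instr.exec, State.setReg]
      rw [Function.update_of_ne this, r2 i (by omega), r1 i (by omega)]
    · simp only [Instr.exec, State.setReg, Function.update_self]
      have := q2 1
      rw [q1] at this
      exact this
  rintro s3 ⟨m3, r3, q3⟩
  refine (Program.Spec.instr (Q := fun s' => s'.mem = s.mem ∧
    (∀ i, i < 10 ∨ i = 14 → s'.reg i = s.reg i) ∧ s'.reg 18 = 4 * i + 1 ∧ s'.reg 16 = j) ?_).seq ?_
  · rw [Instr.exec, r3 8 (by norm_num), r3 5 (by norm_num), h8, h5, word_eq hg]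
    refine ⟨m3, fun i hi => ?_, by simp [State.setReg, q3], by simp [State.setReg, Gate.words]⟩
    have : i ≠ 16 := by omega
    simp [State.setReg, this, r3 i hi]
  rintro s4 ⟨m4, r4, q4, p4⟩
  refine ((loadQubit_spec (Or.inr (by norm_num))).mono (by rw [p4]; omega) fun _ h => h).seq ?_
  rintro s5 ⟨m5, r5, q5⟩
  have e18 : s5.reg 18 = 4 * i + 1 := (r5 18 (by norm_num)).trans q4
  have e14 : s5.reg 14 = 4 * n + 2 * h := by
    rw [r5 14 (by norm_num), r4 14 (by norm_num), h14]
  have e11 : s5.reg 11 = 4 * j + 1 := by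
    have := q5 1
    rw [p4] at this
    exact this
  refine (Program.Spec.block (Q := fun s' => s'.mem = s.mem ∧ (∀ i, i < 9 → s'.reg i = s.reg i) ∧
    s'.reg 14 = 4 * n + 2 * (h + 1) ∧
    ∀ r : Fin 4, s'.reg (10 + r) = (idx ∘ csignModes i j h) r) ?_).seq ?_
  · refine ⟨m5.trans m4, fun i hi => ?_, ?_, fun r => ?_⟩
    · have a1 : i ≠ 10 := by omega
      have a2 : i ≠ 12 := by omega
      have a3 : i ≠ 13 := by omega
      have a4 : i ≠ 14 := by omega
      simp [execs, Instr.exec, State.setReg, a1, a2, a3, a4]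
      rw [r5 i (by omega), r4 i (by omega)]
    · simp [execs, Instr.exec, State.setReg, e14]
      ring
    · fin_cases r <;> simp [execs, Instr.exec, State.setReg, e14, e18, e11, csignModes, idx]
  rintro s6 ⟨m6, r6, q6, p6⟩
  have hF' := hF.congr fun i hi => r6 i (by omega)
  refine ((hs.congr m6 fun _ h => h).applyGate knill_mul_transpose (csignModes_injective hij h)
    ⟨hF'.size, hF'.num, p6⟩ (scales_matrixInstr _ _ _)
    fun f hf => hf.csign hg hh).mono le_rfl ?_
  rintro s' ⟨h1, h2⟩
  exact ⟨fun i hi => by rw [h1 i (by omega), r6 i hi], by rw [h1 14 (by norm_num), q6], h2⟩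

/-- Apply all gates of the circuit. -/
def allGates : Program :=
  .loop 1 (.seq (.instr (.read 15 8 3)) (.seq (.ifEq 15 4 csignGate singleGate)
    (.instr (.succ 8))))

theorem allGates_spec {s : State} {Q : Circuit n}
    (hF : Frame s.reg n Q.length (4 * n + 2 * Q.csignCount)) (h8 : s.reg 8 = 0)
    (h14 : s.reg 14 = 4 * n) (hs : Holds (n := n) (Γ := Q.csignCount) s (Simulates Q 0)) :
    allGates.Spec Q.toInput s
      (1 + Q.length * (33 + 12 * n + 59 * (4 * n + 2 * Q.csignCount))) fun s' =>
      (∀ i, i < 8 → s'.reg i = s.reg i) ∧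
        Holds (n := n) (Γ := Q.csignCount) s' (Simulates Q Q.length) := by
  refine (Program.Spec.loop (c := Q.length) hF.gates (fun k s' =>
    (∀ i, i < 8 → s'.reg i = s.reg i) ∧ s'.reg 8 = k ∧ s'.reg 14 = 4 * n + 2 * used Q k ∧
    Holds (n := n) (Γ := Q.csignCount) s' (Simulates Q k))
    (t := 1 + ((29 + 12 * n + 59 * (4 * n + 2 * Q.csignCount) + 1) + 1)) ?_ ?_).mono
    (le_of_eq (by ring)) fun s' h => ⟨h.1, h.2.2.2⟩
  · refine ⟨fun _ _ => rfl, h8, ?_, hs⟩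
    simp [h14, used, Circuit.csignCount]
  rintro k hk s1 ⟨r1, k1, c1, H1⟩
  obtain ⟨g, hg⟩ : ∃ g, Q[k]? = some g := ⟨_, List.getElem?_eq_getElem hk⟩
  have h3 : s1.reg 3 = 0 := (r1 3 (by norm_num)).trans (hF.num 0 (by norm_num))
  have h4 : s1.reg 4 = 1 := (r1 4 (by norm_num)).trans (hF.num 1 (by norm_num))
  refine (Program.Spec.instr (Q := fun s' => s' = s1.setReg 15 (g.words 0)) ?_).seq ?_
  · rw [Instr.exec, k1, h3, word_eq hg]
  rintro s2 rfl
  have r2 : ∀ i, i ≠ 15 → (s1.setReg 15 (g.words 0)).reg i = s1.reg i := by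
    intro i hi
    simp [State.setReg, hi]
  have e15 : (s1.setReg 15 (g.words 0)).reg 15 = g.words 0 := by simp [State.setReg]
  have hF2 : Frame (s1.setReg 15 (g.words 0)).reg n Q.length (4 * n + 2 * Q.csignCount) :=
    hF.congr fun i hi => (r2 i (by omega)).trans (r1 i hi)
  have H2 : Holds (n := n) (Γ := Q.csignCount) (s1.setReg 15 (g.words 0)) (Simulates Q k) :=
    H1.congr rfl fun _ h => h
  refine Program.Spec.seq (Q := fun s' => (∀ i, i < 9 → s'.reg i = s1.reg i) ∧
    s'.reg 14 = 4 * n + 2 * used Q (k + 1) ∧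
    Holds (n := n) (Γ := Q.csignCount) s' (Simulates Q (k + 1))) (Program.Spec.ifEq ?_ ?_) ?_
  · intro h
    rw [e15, r2 4 (by norm_num), h4] at h
    cases g with
    | single q G => exact absurd h (by simp [Gate.words])
    | csign i j hij =>
      have hu := used_succ hg
      simp only [Gate.isCsign, if_true] at hu
      -- An unused helper pair exists because the present gate is itself counted.
      have hlt : used Q k < Q.csignCount := by
        have := used_le Q (k + 1)
        omega
      refine (csignGate_spec hg (h := ⟨used Q k, hlt⟩) rfl hF2 ((r2 8 (by norm_num)).trans k1)
        ((r2 14 (by norm_num)).trans c1) H2).mono le_rfl ?_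
      rintro s' ⟨a1, a2, a3⟩
      exact ⟨fun i hi => (a1 i hi).trans (r2 i (by omega)), by rw [a2, hu], a3⟩
  · intro h
    rw [e15, r2 4 (by norm_num), h4] at h
    cases g with
    | csign i j hij => exact absurd rfl h
    | single q G =>
      have hu := used_succ hg
      simp only [Gate.isCsign] at hu
      refine (singleGate_spec hg hF2 ((r2 8 (by norm_num)).trans k1) H2).mono (by omega) ?_
      rintro s' ⟨a1, a2⟩
      refine ⟨fun i hi => (a1 i (Or.inl hi)).trans (r2 i (by omega)), ?_, a2⟩
      rw [a1 14 (by norm_num), r2 14 (by norm_num), c1, hu]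
      rfl
  · rintro s3 ⟨a1, a2, a3⟩
    apply Program.Spec.instr
    refine ⟨fun i hi => ?_, by simp [Instr.exec, State.setReg, a1 8 (by norm_num), k1],
      by simp [Instr.exec, State.setReg, a2], a3.congr rfl fun _ h => h⟩
    simp only [Instr.exec, State.setReg]
    rw [Function.update_of_ne (by omega), a1 i (by omega), r1 i hi]

/-! ### Initialization -/

/-- Set up the small numbers, the size of the matrix, and the identity matrix. -/
def setup : Program :=
  .seq (.block [.succ 4, .copy 5 4, .succ 5, .copy 6 5, .succ 6, .copy 7 6, .succ 7]) <|
  .seq (.loop 0 (.block [.succ 2, .succ 2, .succ 2, .succ 2])) <|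
  .seq (.instr (.copy 14 2)) <|
  .seq (.loop 1 (.seq (.instr (.read 15 8 3))
    (.seq (.ifEq 15 4 (.block [.succ 2, .succ 2]) (.block [])) (.instr (.succ 8))))) <|
  .seq (.instr (.clear 8)) <|
  .loop 2 (.block [.const 9 9 ⟨1, isAlgebraic_one⟩, .succ 9])

theorem setup_spec (Q : Circuit n) :
    setup.Spec Q.toInput Q.initState
      (13 + 6 * n + 7 * Q.length + 4 * (4 * n + 2 * Q.csignCount)) fun s' =>
      Frame s'.reg n Q.length (4 * n + 2 * Q.csignCount) ∧ s'.reg 8 = 0 ∧ s'.reg 14 = 4 * n ∧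
        ∀ i j, i < 4 * n + 2 * Q.csignCount → s'.mem i j = if i = j then 1 else 0 := by
  refine (Program.Spec.block (Q := fun s' => s'.mem = (fun _ _ => 0) ∧
    Frame s'.reg n Q.length 0 ∧ s'.reg 8 = 0 ∧ s'.reg 9 = 0) ?_).seq ?_ |>.mono
    (t := 8 + ((1 + n * (5 + 1)) + (1 + ((1 + Q.length * ((1 + ((3 + 1) + 1)) + 1)) + (1 +
      (1 + (4 * n + 2 * Q.csignCount) * (3 + 1))))))) (le_of_eq (by ring)) fun _ h => h
  · refine ⟨rfl, ⟨?_, ?_, ?_, ?_⟩, ?_, ?_⟩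
    · simp [execs, Instr.exec, State.setReg, Circuit.initState]
    · simp [execs, Instr.exec, State.setReg, Circuit.initState]
    · simp [execs, Instr.exec, State.setReg, Circuit.initState]
    · intro r hr
      interval_cases r <;> simp [execs, Instr.exec, State.setReg, Circuit.initState]
    · simp [execs, Instr.exec, State.setReg, Circuit.initState]
    · simp [execs, Instr.exec, State.setReg, Circuit.initState]
  rintro s1 ⟨m1, F1, h8, h9⟩
  refine (Program.Spec.loop (c := n) F1.qubits (fun k s' => s'.mem = (fun _ _ => 0) ∧
    (∀ i, i ≠ 2 → s'.reg i = s1.reg i) ∧ s'.reg 2 = 4 * k) ?_ ?_).seq ?_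
  · exact ⟨m1, fun _ _ => rfl, F1.size⟩
  · rintro k - s' ⟨a1, a2, a3⟩
    apply Program.Spec.block
    refine ⟨a1, fun i hi => ?_, ?_⟩
    · simp [execs, Instr.exec, State.setReg, hi, a2 i hi]
    · simp [execs, Instr.exec, State.setReg, a3]
      ring
  rintro s2 ⟨m2, r2, q2⟩
  refine (Program.Spec.instr (Q := fun s' => s'.mem = (fun _ _ => 0) ∧
    (∀ i, i ≠ 2 ∧ i ≠ 14 → s'.reg i = s1.reg i) ∧ s'.reg 2 = 4 * n ∧ s'.reg 14 = 4 * n) ?_).seq ?_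
  · refine ⟨m2, fun i hi => ?_, ?_, ?_⟩
    · simp [Instr.exec, State.setReg, hi, r2 i hi.1]
    · simp [Instr.exec, State.setReg, q2]
    · simp [Instr.exec, State.setReg, q2]
  rintro s3 ⟨m3, r3, q3, p3⟩
  refine (Program.Spec.loop (c := Q.length) ((r3 1 (by norm_num)).trans F1.gates) (fun k s' =>
    s'.mem = (fun _ _ => 0) ∧ (∀ i, i < 10 → i ≠ 2 → i ≠ 8 → s'.reg i = s1.reg i) ∧
    s'.reg 14 = 4 * n ∧ s'.reg 2 = 4 * n + 2 * used Q k ∧ s'.reg 8 = k) ?_ ?_).seq ?_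
  · refine ⟨m3, fun i hi h2 _ => r3 i ⟨h2, by omega⟩, p3, ?_, (r3 8 (by norm_num)).trans h8⟩
    simp [q3, used, Circuit.csignCount]
  · rintro k hk s' ⟨a1, a2, a3, a4, a5⟩
    obtain ⟨g, hg⟩ : ∃ g, Q[k]? = some g := ⟨_, List.getElem?_eq_getElem hk⟩
    have h3 : s'.reg 3 = 0 :=
      (a2 3 (by norm_num) (by norm_num) (by norm_num)).trans (F1.num 0 (by norm_num))
    have h4 : s'.reg 4 = 1 :=
      (a2 4 (by norm_num) (by norm_num) (by norm_num)).trans (F1.num 1 (by norm_num))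
    refine (Program.Spec.instr (Q := fun s'' => s'' = s'.setReg 15 (g.words 0)) ?_).seq ?_
    · rw [Instr.exec, a5, h3, word_eq hg]
    rintro s4 rfl
    have b2 : ∀ i, i ≠ 15 → (s'.setReg 15 (g.words 0)).reg i = s'.reg i := by
      intro i hi
      simp [State.setReg, hi]
    have e15 : (s'.setReg 15 (g.words 0)).reg 15 = g.words 0 := by simp [State.setReg]
    refine Program.Spec.seq (t := 3 + 1) (t' := 1) (Q := fun s'' => s''.mem = (fun _ _ => 0) ∧
      (∀ i, i < 10 ∨ i = 14 → i ≠ 2 → s''.reg i = s'.reg i) ∧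
      s''.reg 2 = 4 * n + 2 * used Q (k + 1)) (Program.Spec.ifEq ?_ ?_) ?_
    · intro h
      rw [e15, b2 4 (by norm_num), h4] at h
      have hu := used_succ hg
      cases g with
      | single q G => exact absurd h (by simp [Gate.words])
      | csign i j hij =>
        simp only [Gate.isCsign, if_true] at hu
        apply Program.Spec.block
        refine ⟨a1, fun i hi h2 => ?_, ?_⟩
        · have : i ≠ 15 := by omega
          simp [execs, Instr.exec, State.setReg, h2, this]
        · simp [execs, Instr.exec, State.setReg, a4, hu]
          ring
    · intro h
      rw [e15, b2 4 (by norm_num), h4] at h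
      have hu := used_succ hg
      cases g with
      | csign i j hij => exact absurd rfl h
      | single q G =>
        simp only [Gate.isCsign] at hu
        refine (Program.Spec.block (l := []) ⟨a1, fun i hi h2 => ?_, ?_⟩).mono (by simp)
          fun _ h => h
        · have : i ≠ 15 := by omega
          simp [execs, State.setReg, this]
        · rw [hu]
          simp [execs, State.setReg, a4]
    · rintro s5 ⟨c1, c2, c3⟩
      apply Program.Spec.instr
      refine ⟨c1, fun i hi h2 h8 => ?_, ?_, ?_, ?_⟩
      · simp only [Instr.exec, State.setReg]
        rw [Function.update_of_ne h8, c2 i (Or.inl hi) h2, a2 i hi h2 h8]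
      · simp [Instr.exec, State.setReg, c2 14 (by norm_num), a3]
      · simp [Instr.exec, State.setReg, c3]
      · simp [Instr.exec, State.setReg, c2 8 (by norm_num), a5]
  rintro s4 ⟨m4, r4, p4, q4, -⟩
  refine (Program.Spec.instr (Q := fun s' => s' = s4.setReg 8 0) rfl).seq ?_
  rintro s5 rfl
  have hN : (s4.setReg 8 0).reg 2 = 4 * n + 2 * Q.csignCount := by
    have : used Q Q.length = Q.csignCount := by rw [used, List.take_length]
    simp [State.setReg, q4, this]
  have F5 : Frame (s4.setReg 8 0).reg n Q.length (4 * n + 2 * Q.csignCount) := by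
    refine ⟨?_, ?_, hN, fun r hr => ?_⟩
    · simp [State.setReg, r4 0, F1.qubits]
    · simp [State.setReg, r4 1, F1.gates]
    · simp only [State.setReg]
      rw [Function.update_of_ne (by omega), r4 _ (by omega) (by omega) (by omega), F1.num r hr]
  -- Memory starts at zero, so only the diagonal has to be written, which keeps the cost linear.
  refine (Program.Spec.loop (c := 4 * n + 2 * Q.csignCount) hN (fun k s' =>
    (∀ i, i ≠ 9 → s'.reg i = (s4.setReg 8 0).reg i) ∧ s'.reg 9 = k ∧
    ∀ i j, s'.mem i j = if i = j ∧ i < k then 1 else 0) ?_ ?_).mono le_rfl ?_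
  · refine ⟨fun _ _ => rfl, by simp [State.setReg, r4 9, h9], fun i j => ?_⟩
    simp [State.setReg, m4]
  · rintro k - s' ⟨a1, a2, a3⟩
    apply Program.Spec.block
    refine ⟨fun i hi => ?_, ?_, fun i j => ?_⟩
    · simp [execs, Instr.exec, State.setReg, State.setCell, hi, a1 i hi]
    · simp [execs, Instr.exec, State.setReg, State.setCell, a2]
    · simp only [execs, List.foldl_cons, List.foldl_nil, Instr.exec, State.setReg, State.setCell,
        a2, a3]
      split_ifs <;> first | rfl | omega
  · rintro s' ⟨a1, -, a3⟩
    refine ⟨F5.congr fun i hi => a1 i (by omega), ?_, ?_, fun i j hi => ?_⟩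
    · rw [a1 8 (by norm_num)]; simp [State.setReg]
    · rw [a1 14 (by norm_num)]; simp [State.setReg, p4]
    · rw [a3]; simp [hi]

/-! ### The whole program -/

/-- The program that computes the linear optical circuit. -/
def compile : Program :=
  .seq setup <| .seq (sweep (matrixInstr encoder isAlgebraic_encoder)) <| .seq allGates <|
    .seq (sweep (matrixInstr decoder isAlgebraic_decoder)) (.instr (.copy 0 2))

theorem compile_spec (Q : Circuit n) :
    compile.Spec Q.toInput Q.initState (1000 * (n + Q.length + 1) ^ 2) fun s' =>
      s'.reg 0 = 4 * n + 2 * Q.csignCount ∧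
      Holds (n := n) (Γ := Q.csignCount) s' (Decoded n
        fun x => ((-1 / 2 : ℝ) ^ n * (√6 / 9) ^ Q.csignCount) * evolve Q x) := by
  have hN : Q.csignCount ≤ Q.length := List.countP_le_length
  have hu : used Q Q.length = Q.csignCount := by rw [used, List.take_length]
  refine ((setup_spec Q).seq ?_).mono
    (t := (13 + 6 * n + 7 * Q.length + 4 * (4 * n + 2 * Q.csignCount)) +
      ((2 + n * (13 + 6 * n + 59 * (4 * n + 2 * Q.csignCount))) +
      ((1 + Q.length * (33 + 12 * n + 59 * (4 * n + 2 * Q.csignCount))) +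
      ((2 + n * (13 + 6 * n + 59 * (4 * n + 2 * Q.csignCount))) + 1)))) ?_ fun _ h => h
  · rintro s1 ⟨F1, h8, h14, hm⟩
    have H1 : Holds (n := n) (Γ := Q.csignCount) s1 (Encoded 0) := by
      refine ⟨1, by simp, fun i j => ?_, ?_⟩
      · rw [hm _ _ (idx_lt i), Matrix.one_apply]
        simp only [idx_injective.eq_iff]
      · rw [lift_one]
        exact encoded_zero
    refine (sweep_spec Encoded F1 H1 encoder_mul_transpose
      (scales_matrixInstr _ isAlgebraic_encoder) fun q f hf => hf.step).seq ?_
    rintro s2 ⟨r2, H2⟩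
    have F2 := F1.congr fun i hi => r2 i (by omega)
    refine (allGates_spec F2 ((r2 8 (by norm_num)).trans h8) ((r2 14 (by norm_num)).trans h14)
      (H2.congr rfl fun f hf => ?_)).seq ?_
    · have h0 : used Q 0 = 0 := by simp [used, Circuit.csignCount]
      rw [Simulates, h0]
      convert hf.encodes using 2 with x
      simp [evolve, Pi.single_apply]
    rintro s3 ⟨r3, H3⟩
    have F3 := F2.congr r3
    refine (sweep_spec (fun k => Decoded (Γ := Q.csignCount) k
      fun x => ((-1 / 2 : ℝ) ^ n * (√6 / 9) ^ Q.csignCount) * evolve Q x) F3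
      (H3.congr rfl fun f hf => ?_) decoder_mul_transpose
      (scales_matrixInstr _ isAlgebraic_decoder) fun q f hf => hf.step).seq ?_
    · apply Encodes.decoded
      rw [Simulates, hu, List.take_length] at hf
      exact hf
    rintro s4 ⟨r4, H4⟩
    apply Program.Spec.instr
    refine ⟨?_, H4.congr rfl fun _ h => h⟩
    simp [Instr.exec, State.setReg, r4 2, F3.size]
  -- The step count is quadratic because `Γ ≤ L`; 1000 is a generous constant.
  · nlinarith [Nat.mul_le_mul_left n hN, Nat.mul_le_mul_left Q.length hN,
      Nat.zero_le (n * Q.length), Nat.zero_le (n * n), Nat.zero_le (Q.length * Q.length)]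

end Compiler

end

theorem theorem3p4 :
    ∃ (P : RealMachine.Program) (p : Polynomial ℕ),
      ∀ (n : ℕ) (Q : QubitCircuit.Circuit n),
        ∃ O : Matrix (Fin (4 * n + 2 * Q.csignCount)) (Fin (4 * n + 2 * Q.csignCount)) ℝ,
          O ∈ Matrix.orthogonalGroup (Fin (4 * n + 2 * Q.csignCount)) ℝ ∧
          LinearOptics.amplitude (O.map fun x : ℝ => (x : ℂ))
              (LinearOptics.allOnes _) (LinearOptics.allOnes _) =
            (((1 / 3 * Real.sqrt (2 / 3)) ^ Q.csignCount * (-1 / Real.sqrt 6) ^ n : ℝ) : ℂ) *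
              Q.zeroAmplitude ∧
          P.Computes Q O (p.eval (n + Q.length)) := by
  refine ⟨Compiler.compile, 1000 * (Polynomial.X + 1) ^ 2, fun n Q => ?_⟩
  obtain ⟨⟨hN, M, hM, hmem, hdec⟩, ht⟩ := Compiler.compile_spec Q
  set e := Compiler.idxEquiv n Q.csignCount with he
  refine ⟨M.reindex e e, ?_, ?_, ?_, hN, ?_⟩
  · rw [Matrix.mem_orthogonalGroup_iff, Matrix.transpose_reindex, Matrix.reindex_apply,
      Matrix.reindex_apply, Matrix.submatrix_mul_equiv, hM, Matrix.submatrix_one_equiv]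
  · have h6 : √6 * √6 = 6 := Real.mul_self_sqrt (by norm_num)
    have h1 : 1 / 3 * √(2 / 3) = √6 / 9 := by
      rw [show (2 / 3 : ℝ) = 6 / 3 ^ 2 by norm_num, Real.sqrt_div (by norm_num),
        Real.sqrt_sq (by norm_num)]
      ring
    -- The factor of one qubit, split into its decoder and encoder amplitudes.
    have h2 : -1 / √6 = √6 / 3 * (-1 / 2) := by
      have : √6 ≠ 0 := by positivity
      field_simp
      linear_combination h6
    rw [Optics.amplitude_allOnes, hdec.cf_eq, Optics.zeroAmplitude_eq, h1, h2, mul_pow]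
    push_cast
    ring
  · simpa using ht
  · intro i j
    have := hmem (e.symm i) (e.symm j)
    rw [← Compiler.idxEquiv_apply, ← Compiler.idxEquiv_apply, ← he, e.apply_symm_apply,
      e.apply_symm_apply] at this
    rw [this]
    rfl
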